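/- Let $L$ be a two-dimensional local field of mixed characteristic, that is, a complete discrete valuation field of characteristic zero, with ring of integers $\mathcal{O}_L$, whose residue field $\overline{L}$ is a (non-archimedean) local field of characteristic $p>0$. The closure of $\mathbb{Q}$ in $L$ is a copy of $\mathbb{Q}_p$; let $k_L$, the constant subfield, be its algebraic closure inside $L$. Assume that $L$ is standard, i.e. that the ramification index $e(L/k_L)$ is $1$, and let $K\subseteq L$ be a subfield which is a local field, $\mathcal{O}_K=K\cap\mathcal{O}_L$. For an $\mathcal{O}_L$-module $N$ put $N^{\mathrm{sep}}=N/\bigcap_{n}\mathfrak{m}^nN$, where $\mathfrak{m}$ is the maximal ideal of $\mathcal{O}_L$, and put $\Omega^{\mathrm{cts}}_{L/K}=\Omega^{\mathrm{sep}}_{\mathcal{O}_L/\mathcal{O}_K}\otimes_{\mathcal{O}_L}L$. Let $k_L\{\{X\}\}$ be the field of formal series $\sum_{i\in\mathbb{Z}}a_iX^i$ with $a_i\in k_L$ whose valuations are bounded below and with $a_i\to0$ as $i\to-\infty$. A first local parameter of $L$ is an element $t\in\mathcal{O}_L$ whose image in $\overline{L}$ is a uniformiser of $\overline{L}$. Then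 every $k_L$-isomorphism of fields $\varphi:k_L\{\{X\}\}\to L$ sends $X$ to a first local parameter $t=\varphi(X)$, and $\Omega^{\mathrm{cts}}_{L/K}$ is a one-dimensional $L$-vector space with basis $dt$, so that $\varphi$ defines a residue map $$\operatorname{Res}_\varphi:\Omega^{\mathrm{cts}}_{L/K}\to k_L,\qquad f\,dt\mapsto-\operatorname{coeff}_{X^{-1}}\bigl(\varphi^{-1}(f)\bigr).$$ This map does not depend on the choice of $\varphi$ (and hence not on the first local parameter $t=\varphi(X)$): there is a single $k_L$-linear map $\operatorname{Res}_L:\Omega^{\mathrm{cts}}_{L/K}\to k_L$ such that $\operatorname{Res}_L(f\,dt)=-\operatorname{coeff}_{X^{-1}}(\varphi^{-1}(f))$ for every such $\varphi$, with $t=\varphi(X)$, and every $f\in L$. -/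

import Mathlib

open scoped TensorProduct

noncomputable section

namespace TwoDimLocal

universe u

/-! ### Complete discrete valuation fields and local fields -/

section Fields

variable {F : Type u} [Field F]

/-- `A` is the ring of integers of a complete discrete valuation on the field `F`. -/
structure IsCompleteDVR (A : ValuationSubring F) : Prop where
  dvr : IsDiscreteValuationRing A
  complete : IsAdicComplete (IsLocalRing.maximalIdeal A) A

/-- `A` is the ring of integers of a (non-archimedean) local field structure on `F`: a complete
discrete valuation ring with finite residue field. -/
structure IsLocalFieldIntegers (A : ValuationSubring F) : Prop extends IsCompleteDVR A where
  finite : Finite (IsLocalRing.ResidueField A)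

variable (F) in
/-- `F` is a (non-archimedean) local field. -/
def IsLocalField : Prop := ∃ A : ValuationSubring F, IsLocalFieldIntegers A

/-- The field `F` with the complete discrete valuation whose ring of integers is `O` is a
two-dimensional local field of mixed characteristic: `F` has characteristic zero, and the residue
field is a local field of positive characteristic. -/
structure IsMixedTwoDimLocalField (O : ValuationSubring F) : Prop extends IsCompleteDVR O where
  charZero : CharZero F
  residue : IsLocalField (IsLocalRing.ResidueField O)
  residueChar : ∃ p : ℕ, p.Prime ∧ CharP (IsLocalRing.ResidueField O) p

/-- A first local parameter: an element `t` of the ring of integers whose image in the residue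
field (a local field) is a uniformiser. (A local field has only one ring of integers.) -/
def IsFirstLocalParameter (O : ValuationSubring F) (t : O) : Prop :=
  ∃ A : ValuationSubring (IsLocalRing.ResidueField O), IsLocalFieldIntegers A ∧
    ∃ s : A, Irreducible s ∧ (s : IsLocalRing.ResidueField O) = IsLocalRing.residue O t

/-- The field `F` with the valuation topology. -/
abbrev valued (A : ValuationSubring F) : Valued F A.ValueGroup := Valued.mk' A.valuation

/-- The topological closure of `ℚ` in a field with a valuation ring; for a two-dimensional local
field of residue characteristic `p > 0` this is the copy of `ℚ_p` in it. -/
def padicSubfield (O : ValuationSubring F) : Subfield F :=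
  letI := valued O
  (⊥ : Subfield F).topologicalClosure

/-- The constant subfield: the algebraic closure of `ℚ_p` inside the field. -/
def constantField (O : ValuationSubring F) : Subfield F :=
  (algebraicClosure (padicSubfield O) F).toSubfield

/-- The ring of integers `k ∩ O` of a subfield `k`, as a valuation ring of `k`. -/
abbrev integersOf (O : ValuationSubring F) (k : Subfield F) : ValuationSubring k :=
  O.comap k.subtype

/-- The ramification index `e(F/k)`: the index of the value group of `k` in that of `F`
(with the value `0` for an infinite index). -/
def ramificationIndex (O : ValuationSubring F) (k : Subfield F) : ℕ :=
  ((Units.map (k.subtype : k →* F)).range.map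
    (Units.map (O.valuation : F →* O.ValueGroup))).index

/-- A two-dimensional local field of mixed characteristic is standard if it has ramification
index one over its constant subfield. -/
def IsStandard (O : ValuationSubring F) : Prop :=
  ramificationIndex O (constantField O) = 1

end Fields

/-! ### The field `K{{t}}` -/

section DoubleCurly

variable {K : Type u} [Field K] (A : ValuationSubring K)

/-- The set `K{{t}}` of formal series `∑ aᵢ tⁱ`, `i ∈ ℤ`, with coefficients in the field `K` with
ring of integers `A`, such that the values of the `aᵢ` are bounded and `aᵢ → 0` as `i → -∞`. -/
@[ext]
structure DoubleCurly where
  coeff : ℤ → K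
  bounded : ∃ γ : A.ValueGroup, ∀ i, A.valuation (coeff i) ≤ γ
  tendsto : ∀ γ : A.ValueGroup, γ ≠ 0 → ∃ N : ℤ, ∀ i ≤ N, A.valuation (coeff i) < γ

variable {A}

theorem valuation_tsum_le (f : ℤ → K) (γ : A.ValueGroup) (h : ∀ r, A.valuation (f r) ≤ γ) :
    letI := valued A
    A.valuation (∑' r, f r) ≤ γ := by
  let := valued A
  by_cases hs : Summable f
  · obtain ⟨y, rfl⟩ := A.valuation_surjective γ
    have hc : IsClosed {x : K | A.valuation x ≤ A.valuation y} := by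
      have := Valued.isClosed_closedBall K ((Valued.v : Valuation K A.ValueGroup).restrict y)
      simp only [Valuation.restrict_le_iff] at this
      exact this
    refine hc.mem_of_tendsto hs.hasSum (Filter.Eventually.of_forall fun s => ?_)
    exact A.valuation.map_sum_le fun r _ => h r
  · rw [tsum_eq_zero_of_not_summable hs]
    simp

namespace DoubleCurly

instance : Add (DoubleCurly A) where
  add a b :=
    { coeff := fun i => a.coeff i + b.coeff i
      bounded := by
        obtain ⟨γ, hγ⟩ := a.bounded
        obtain ⟨δ, hδ⟩ := b.bounded
        exact ⟨max γ δ, fun i => (A.valuation.map_add _ _).trans (max_le_max (hγ i) (hδ i))⟩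
      tendsto := by
        intro γ hγ
        obtain ⟨M, hM⟩ := a.tendsto γ hγ
        obtain ⟨N, hN⟩ := b.tendsto γ hγ
        exact ⟨min M N, fun i hi => A.valuation.map_add_lt (hM i (hi.trans (min_le_left _ _)))
          (hN i (hi.trans (min_le_right _ _)))⟩ }

/-- The product of series: the `i`-th coefficient is the sum `∑ᵣ aᵣ bᵢ₋ᵣ` in the valuation
topology of `K`, which converges if `K` is complete. -/
instance : Mul (DoubleCurly A) where
  mul a b :=
    { coeff := fun i =>
        letI := valued A
        ∑' r : ℤ, a.coeff r * b.coeff (i - r)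
      bounded := by
        obtain ⟨γ, hγ⟩ := a.bounded
        obtain ⟨δ, hδ⟩ := b.bounded
        refine ⟨γ * δ, fun i => valuation_tsum_le _ _ fun r => ?_⟩
        rw [map_mul]
        exact mul_le_mul' (hγ r) (hδ _)
      tendsto := by
        intro ε hε
        obtain ⟨γ, hγ⟩ := a.bounded
        obtain ⟨δ, hδ⟩ := b.bounded
        -- a common nonzero bound, and an element strictly below `ε` if there is one
        set μ : A.ValueGroup := max 1 (max γ δ) with hμ
        have hμ1 : (1 : A.ValueGroup) ≤ μ := le_max_left _ _
        have hμ0 : μ ≠ 0 := (lt_of_lt_of_le zero_lt_one hμ1).ne'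
        have ha : ∀ r, A.valuation (a.coeff r) ≤ μ := fun r =>
          (hγ r).trans ((le_max_left _ _).trans (le_max_right _ _))
        have hb : ∀ r, A.valuation (b.coeff r) ≤ μ := fun r =>
          (hδ r).trans ((le_max_right _ _).trans (le_max_right _ _))
        by_cases hex : ∃ ε' : A.ValueGroup, ε' ≠ 0 ∧ ε' < ε
        · obtain ⟨ε', hε', hlt⟩ := hex
          have hq : ε' * μ⁻¹ ≠ 0 := mul_ne_zero hε' (inv_ne_zero hμ0)
          obtain ⟨M, hM⟩ := a.tendsto _ hq
          obtain ⟨N, hN⟩ := b.tendsto _ hq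
          refine ⟨M + N, fun i hi => lt_of_le_of_lt (valuation_tsum_le _ ε' fun r => ?_) hlt⟩
          rw [map_mul]
          rcases le_total r M with h | h
          · calc _ ≤ ε' * μ⁻¹ * μ := mul_le_mul' (hM r h).le (hb _)
              _ = ε' := by rw [mul_assoc, inv_mul_cancel₀ hμ0, mul_one]
          · calc _ ≤ μ * (ε' * μ⁻¹) := mul_le_mul' (ha r) (hN (i - r) (by omega)).le
              _ = ε' := by rw [mul_comm, mul_assoc, inv_mul_cancel₀ hμ0, mul_one]
        · have hq : ε * μ⁻¹ ≠ 0 := mul_ne_zero hε (inv_ne_zero hμ0)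
          push Not at hex
          obtain ⟨M, hM⟩ := a.tendsto _ hε
          obtain ⟨N, hN⟩ := b.tendsto _ hε
          refine ⟨M + N, fun i hi =>
            lt_of_le_of_lt (valuation_tsum_le _ 0 fun r => ?_) (zero_lt_iff.2 hε)⟩
          rw [map_mul]
          rcases le_total r M with h | h
          · have : A.valuation (a.coeff r) = 0 := by
              by_contra h0
              exact absurd (hM r h) (not_lt.2 (hex _ h0))
            rw [this, zero_mul]
          · have : A.valuation (b.coeff (i - r)) = 0 := by
              by_contra h0
              exact absurd (hN (i - r) (by omega)) (not_lt.2 (hex _ h0))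
            rw [this, mul_zero] }

variable (A) in
/-- The monomial `c tⁿ`. -/
def monomial (n : ℤ) (c : K) : DoubleCurly A where
  coeff := Pi.single n c
  bounded := ⟨A.valuation c, fun i => by
    by_cases h : i = n
    · subst h; simp
    · simp [Pi.single_eq_of_ne h]⟩
  tendsto := fun γ hγ => ⟨n - 1, fun i hi => by
    rw [Pi.single_eq_of_ne (by omega), map_zero]
    exact zero_lt_iff.2 hγ⟩

end DoubleCurly

end DoubleCurly

/-! ### Continuous differential forms -/

section Differentials

/-- The maximal separated quotient of a module over a local ring for the topology given by the
powers of the maximal ideal. -/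
abbrev Sep (A : Type*) [CommRing A] [IsLocalRing A] (N : Type*) [AddCommGroup N] [Module A N] :
    Type _ :=
  N ⧸ (⨅ n : ℕ, (IsLocalRing.maximalIdeal A ^ n • ⊤ : Submodule A N))

variable {L : Type u} [Field L] (O : ValuationSubring L) (K : Subfield L)

/-- The ring `K ∩ O`, as a subring of `O`. -/
abbrev baseRing : Subring O := K.toSubring.comap O.subtype

/-- The `L`-vector space of continuous relative differentials: the separated quotient of the
Kähler differentials of `O` over `K ∩ O`, tensored with `L` over `O`. -/
abbrev ContDifferentials : Type _ := L ⊗[O] Sep O (Ω[O⁄baseRing O K])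

/-- The continuous differential `dt` of an element `t` of the ring of integers. -/
def dCts (t : O) : ContDifferentials O K :=
  (1 : L) ⊗ₜ[O] Submodule.Quotient.mk (KaehlerDifferential.D (baseRing O K) O t)

end Differentials

end TwoDimLocal

end

namespace TwoDimLocal

universe u

/-! ### Complete discrete valuation rings: uniqueness, limits, the valuation topology -/

section General

variable {F : Type u} [Field F]

/-! An isomorphism `φ` is a mere field isomorphism, so the first point is that it respects the
valuations. In a complete discrete valuation ring some `n ≥ 2` is a unit, so by Hensel each element
of `1 + 𝔪` is an `n ^ k`-th power for all `k`, and every discrete valuation of the field vanishes on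
it. Hence the field has only one discrete valuation ring (`IsCompleteDVR.toSubring_eq`). For `L`
this says that integrality is read off the coefficients (`Coordinates.mem_iff`); for the residue
field, that `X` is a first local parameter (`Coordinates.residue_mem_iff`); for `K`, that `K ∩ O` is
its ring of integers and so consists of constants (`Setting.le_constantField`).

For two variables `X`, `X'` it must be shown that `f · dX'/dX` has the same residue in `X` as `f` in
`X'` (`Coordinates.coeff_neg_one_mul_derivative`). If `f = X' ^ i` with `i ≠ -1`, the form is exact.
If `i = -1`, write `X' = X u`; it remains to see that `du/u` has residue zero. This is clear when
`u` and `u⁻¹` are power series. In general they are so only modulo `ϖ`, but raising to the power `p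
^ (c + s)` turns a congruence modulo `ϖ` into one modulo `p ^ s`, and a fixed multiple of the
residue is divisible by every `p ^ s`.

Passing from monomials to all `f` needs continuity: power series in `X'` must have uniformly small
`X`-coefficients in very negative degrees. This holds because modulo `ϖ` the ring `O` is generated
over its `q`-th powers, `q = p ^ n`, by `1, X', …, X' ^ (q - 1)`
(`Coordinates.exists_pow_expansion`), while modulo `ϖ ^ (n + 1)` a `q`-th power depends only on the
residue of its base.

The same expansion with `q = p` shows that `dX` and `dϖ` generate the separated differentials. A
derivation into a separated module kills the `p`-adic integers, so it is torsion on constants and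
`dϖ` dies over `L`. Finally `d/dX` kills `K ∩ O` and induces a functional with value `1` on `dX`, so
`dX` is a basis. -/

theorem IsCompleteDVR.exists_pow_eq {B : ValuationSubring F} (hB : IsCompleteDVR B) {n : ℕ}
    (hn : IsUnit (n : B)) (hn0 : n ≠ 0) {x : B} (hx : x ∈ IsLocalRing.maximalIdeal B) :
    ∃ w : B, w ^ n = 1 + x := by
  have := hB.complete
  obtain ⟨w, hw, -⟩ := HenselianRing.is_henselian (I := IsLocalRing.maximalIdeal B)
    (Polynomial.X ^ n - Polynomial.C (1 + x)) (Polynomial.monic_X_pow_sub_C _ hn0) 1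
    (by simpa using hx) (by
      simpa [Polynomial.derivative_X_pow] using hn.map (Ideal.Quotient.mk (IsLocalRing.maximalIdeal B)))
  refine ⟨w, ?_⟩
  simpa [sub_eq_zero] using hw

/-- A complete discrete valuation ring is the only ring of integers of a discrete valuation
on its field of fractions. -/
theorem IsCompleteDVR.toSubring_eq {B : ValuationSubring F} (hB : IsCompleteDVR B) (g : F → ℤ)
    (hg : ∀ x y, x ≠ 0 → y ≠ 0 → g (x * y) = g x + g y) (V : Subring F)
    (hV : ∀ x, x ≠ 0 → (x ∈ V ↔ 0 ≤ g x)) (hV' : V ≠ ⊤) : V = B.toSubring := by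
  have := hB.dvr
  have hg1 : g 1 = 0 := by
    have := hg 1 1 one_ne_zero one_ne_zero
    rw [one_mul] at this
    omega
  have hpow : ∀ (x : F) (n : ℕ), x ≠ 0 → g (x ^ n) = n * g x := by
    intro x n hx
    induction n with
    | zero => simp [hg1]
    | succ n ih =>
      rw [pow_succ, hg _ _ (pow_ne_zero _ hx) hx, ih]
      push_cast; ring
  -- If `2` is not a unit then `3 = 1 - (-2)` is one, so the residue characteristic plays no role.
  obtain ⟨n, hn2, hn⟩ : ∃ n : ℕ, 2 ≤ n ∧ IsUnit (n : B) := by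
    by_cases h : IsUnit ((2 : ℕ) : B)
    · exact ⟨2, le_rfl, h⟩
    · refine ⟨3, by norm_num, ?_⟩
      have h3 : ((3 : ℕ) : B) = 1 - (-((2 : ℕ) : B)) := by push_cast; norm_num
      rw [h3]
      refine (IsLocalRing.isUnit_or_isUnit_one_sub_self _).resolve_left ?_
      rwa [IsUnit.neg_iff]
  have hm : ∀ x : B, x ∈ IsLocalRing.maximalIdeal B → (x : F) ∈ V := by
    intro x hx
    have hu : IsUnit (1 + x) := by
      have h := (IsLocalRing.isUnit_or_isUnit_one_sub_self (-x)).resolve_left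
        (by rw [IsUnit.neg_iff]; exact hx)
      rwa [sub_neg_eq_add] at h
    have h0 : ((1 + x : B) : F) ≠ 0 := fun h => hu.ne_zero (Subtype.ext h)
    have hdvd : ∀ k : ℕ, ((n : ℤ) ^ k) ∣ g ((1 + x : B) : F) := by
      intro k
      have hnk : IsUnit ((n ^ k : ℕ) : B) := by push_cast; exact hn.pow k
      obtain ⟨w, hw⟩ := hB.exists_pow_eq hnk (pow_ne_zero _ (by omega)) hx
      have hw0 : (w : F) ≠ 0 := by
        rintro h
        have : w = 0 := Subtype.ext h
        rw [this, zero_pow (pow_ne_zero _ (by omega))] at hw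
        exact hu.ne_zero hw.symm
      rw [← hw]
      push_cast
      rw [hpow _ _ hw0]
      push_cast
      exact dvd_mul_right _ _
    -- A nonzero integer `d` is not divisible by `n ^ |d| > |d|`.
    have hgz : g ((1 + x : B) : F) = 0 := by
      by_contra hne
      have hlt := Nat.lt_pow_self (n := (g ((1 + x : B) : F)).natAbs) (a := n) (by omega)
      have := Int.natAbs_dvd_natAbs.2 (hdvd (g ((1 + x : B) : F)).natAbs)
      rw [Int.natAbs_pow, Int.natAbs_natCast] at this
      have := Nat.le_of_dvd (Int.natAbs_pos.2 hne) this
      omega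
    have h1 := (hV _ h0).2 hgz.ge
    have : (x : F) = ((1 + x : B) : F) - 1 := by push_cast; ring
    rw [this]
    exact V.sub_mem h1 V.one_mem
  have hle : B.toSubring ≤ V := by
    intro x hx
    obtain ⟨π, hπ⟩ := IsDiscreteValuationRing.exists_irreducible B
    have hπ0 : (π : F) ≠ 0 := fun h => hπ.ne_zero (Subtype.ext h)
    by_cases hx0 : x = 0
    · rw [hx0]; exact V.zero_mem
    rw [hV _ hx0]
    -- If `g x < 0`, the elements `π * x ^ k` of the maximal ideal have values tending to `-∞`.
    by_contra! hneg
    have hk : ∀ k : ℕ, 0 ≤ g π + k * g x := by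
      intro k
      rw [← hpow _ _ hx0, ← hg _ _ hπ0 (pow_ne_zero _ hx0), ← hV _ (by positivity)]
      have := hm (π * (⟨x, hx⟩ : B) ^ k)
        (Ideal.mul_mem_right _ _ ((IsLocalRing.mem_maximalIdeal _).2 hπ.not_isUnit))
      simpa using this
    have h1 := hk ((g π).toNat + 1)
    have h0 := hk 0
    push_cast at h1 h0
    rw [Int.toNat_of_nonneg (by simpa using h0)] at h1
    nlinarith
  -- In dimension one no valuation ring lies strictly between `B` and its field.
  have hdim : Ring.KrullDimLE 1 B := inferInstance
  have key := ValuationSubring.eq_of_le_of_ne_top (A := B) (B := ValuationSubring.ofLE B V hle) hle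
    (fun h => hV' (by
      ext x
      have : x ∈ ValuationSubring.ofLE B V hle := h ▸ ValuationSubring.mem_top x
      exact ⟨fun _ => trivial, fun _ => this⟩))
  ext x
  exact (SetLike.ext_iff.1 key x).symm

theorem IsCompleteDVR.eq_zero_of_dvd {B : ValuationSubring F} (hB : IsCompleteDVR B) {π : B}
    (hπ : Irreducible π) {x : B} (h : ∀ n : ℕ, π ^ n ∣ x) : x = 0 := by
  have := hB.dvr
  have := hB.complete
  refine IsHausdorff.haus this.toIsHausdorff x fun n => ?_
  rw [hπ.maximalIdeal_eq, Ideal.span_singleton_pow, SModEq.zero, smul_eq_mul, Ideal.mul_top,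
    Ideal.mem_span_singleton]
  exact h n

theorem IsCompleteDVR.exists_limit {B : ValuationSubring F} (hB : IsCompleteDVR B) {π : B}
    (hπ : Irreducible π) (f : ℕ → B) (h : ∀ n : ℕ, π ^ n ∣ f (n + 1) - f n) :
    ∃ x : B, ∀ n : ℕ, π ^ n ∣ x - f n := by
  have := hB.dvr
  have := hB.complete
  have hmn : ∀ m n : ℕ, m ≤ n → π ^ m ∣ f n - f m := by
    intro m n hmn
    induction n, hmn using Nat.le_induction with
    | base => simp
    | succ n hn ih =>
      rw [← sub_add_sub_cancel (f (n + 1)) (f n)]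
      exact dvd_add ((pow_dvd_pow _ hn).trans (h n)) ih
  obtain ⟨x, hx⟩ := IsPrecomplete.prec this.toIsPrecomplete (f := f) (by
    intro m n h
    rw [hπ.maximalIdeal_eq, Ideal.span_singleton_pow, smul_eq_mul, Ideal.mul_top,
      SModEq.sub_mem, Ideal.mem_span_singleton, dvd_sub_comm]
    exact hmn m n h)
  refine ⟨x, fun n => ?_⟩
  have := hx n
  rwa [hπ.maximalIdeal_eq, Ideal.span_singleton_pow, smul_eq_mul, Ideal.mul_top,
      SModEq.sub_mem, Ideal.mem_span_singleton, dvd_sub_comm] at this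

/-- `ϖ ^ n * O`, as an `O`-submodule of the field. -/
def powSubmodule (O : ValuationSubring F) (ϖ : F) (n : ℕ) : Submodule O F where
  carrier := {x | ∃ y ∈ O, x = ϖ ^ n * y}
  add_mem' := by
    rintro _ _ ⟨a, ha, rfl⟩ ⟨b, hb, rfl⟩
    exact ⟨a + b, add_mem ha hb, by ring⟩
  zero_mem' := ⟨0, zero_mem O, by ring⟩
  smul_mem' := by
    rintro c _ ⟨a, ha, rfl⟩
    exact ⟨c * a, mul_mem c.2 ha, by rw [Algebra.smul_def]; change (c : F) * _ = _; ring⟩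

theorem mem_powSubmodule {O : ValuationSubring F} {ϖ : F} {n : ℕ} {x : F} :
    x ∈ powSubmodule O ϖ n ↔ ∃ y ∈ O, x = ϖ ^ n * y := Iff.rfl

theorem valued_mem_nhds (O : ValuationSubring F) (s : Set F) (x : F) :
    letI := valued O
    s ∈ nhds x ↔ ∃ γ : O.ValueGroup, γ ≠ 0 ∧ {y | O.valuation (y - x) < γ} ⊆ s := by
  let := valued O
  have hv : (Valued.v : Valuation F O.ValueGroup) = O.valuation := rfl
  rw [Valued.mem_nhds]
  constructor
  · rintro ⟨γ, hγ⟩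
    refine ⟨MonoidWithZeroHom.ValueGroup₀.embedding γ.1, by simp, ?_⟩
    simp only [Valuation.restrict_lt_iff_lt_embedding] at hγ
    exact hγ
  · rintro ⟨γ, hγ, h⟩
    obtain ⟨a, rfl⟩ := O.valuation_surjective γ
    refine ⟨Units.mk0 (Valued.v.restrict a) (by simpa using hγ), ?_⟩
    intro y hy
    apply h
    exact (Valuation.restrict_lt_iff Valued.v).1 hy

theorem mem_padicSubfield (O : ValuationSubring F) (x : F) :
    x ∈ padicSubfield O ↔ ∀ γ : O.ValueGroup, γ ≠ 0 →
      ∃ q ∈ (⊥ : Subfield F), O.valuation (q - x) < γ := by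
  let := valued O
  have : x ∈ padicSubfield O ↔ x ∈ closure ((⊥ : Subfield F) : Set F) := Iff.rfl
  rw [this, mem_closure_iff_nhds]
  constructor
  · intro h γ hγ
    obtain ⟨q, h1, h2⟩ := h {y | O.valuation (y - x) < γ} ((valued_mem_nhds O _ _).2 ⟨γ, hγ, subset_rfl⟩)
    exact ⟨q, h2, h1⟩
  · intro h t ht
    obtain ⟨γ, hγ, hs⟩ := (valued_mem_nhds O _ _).1 ht
    obtain ⟨q, hq, hqx⟩ := h γ hγ
    exact ⟨q, hs hqx, hq⟩

end General

/-! ### Uniformizers and a criterion for being constant -/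

section General

variable {F : Type u} [Field F]

/-- `ϖ` is a uniformizer of the complete discrete valuation ring `O`. -/
structure IsUniformizer (O : ValuationSubring F) (ϖ : F) : Prop where
  ne_zero : ϖ ≠ 0
  mem : ϖ ∈ O
  inv_notMem : ϖ⁻¹ ∉ O
  decomp : ∀ x : F, x ≠ 0 → ∃ m : ℤ, ∃ u ∈ O, u⁻¹ ∈ O ∧ u ≠ 0 ∧ x = ϖ ^ m * u
  haus : ∀ x : F, (∀ n, x ∈ powSubmodule O ϖ n) → x = 0
  complete : ∀ f : ℕ → F, (∀ n, f n ∈ O) → (∀ n, f (n + 1) - f n ∈ powSubmodule O ϖ n) →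
    ∃ x ∈ O, ∀ n, x - f n ∈ powSubmodule O ϖ n

theorem coe_mem_powSubmodule {O : ValuationSubring F} {π x : O} {n : ℕ} :
    (x : F) ∈ powSubmodule O (π : F) n ↔ π ^ n ∣ x := by
  constructor
  · rintro ⟨y, hy, h⟩
    exact ⟨⟨y, hy⟩, Subtype.ext (by simpa using h)⟩
  · rintro ⟨y, rfl⟩
    exact ⟨y, y.2, by simp⟩

theorem IsCompleteDVR.isUniformizer {O : ValuationSubring F} (hO : IsCompleteDVR O) {π : O}
    (hπ : Irreducible π) : IsUniformizer O (π : F) := by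
  have := hO.dvr
  have h0 : (π : F) ≠ 0 := fun h => hπ.ne_zero (Subtype.ext h)
  have hdec : ∀ x ∈ O, x ≠ 0 → ∃ m : ℕ, ∃ u ∈ O, u⁻¹ ∈ O ∧ u ≠ 0 ∧ x = (π : F) ^ m * u := by
    intro x hx hx0
    obtain ⟨m, u, h⟩ := IsDiscreteValuationRing.eq_unit_mul_pow_irreducible
      (x := (⟨x, hx⟩ : O)) (fun h => hx0 (congrArg Subtype.val h)) hπ
    have hu : (((u⁻¹ : Oˣ) : O) : F) = ((u : O) : F)⁻¹ := by
      refine eq_inv_of_mul_eq_one_left ?_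
      have : ((u⁻¹ : Oˣ) : O) * (u : O) = 1 := by simp
      exact congrArg Subtype.val this
    refine ⟨m, (u : O), (u : O).2, hu ▸ ((u⁻¹ : Oˣ) : O).2,
      fun h => u.ne_zero (Subtype.ext h), ?_⟩
    have := congrArg Subtype.val h
    simpa [mul_comm] using this
  refine ⟨h0, π.2, fun h => hπ.not_isUnit ?_, fun x hx => ?_, fun x hx => ?_, fun f hf h => ?_⟩
  · exact IsUnit.of_mul_eq_one ⟨(π : F)⁻¹, h⟩ (Subtype.ext (mul_inv_cancel₀ h0))
  · rcases O.mem_or_inv_mem x with h | h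
    · obtain ⟨m, u, hu⟩ := hdec x h hx
      exact ⟨m, u, by simpa using hu⟩
    · obtain ⟨m, u, hu1, hu2, hu3, hu4⟩ := hdec _ h (inv_ne_zero hx)
      refine ⟨-m, u⁻¹, hu2, by simpa using hu1, inv_ne_zero hu3, ?_⟩
      rw [← inv_inv x, hu4]
      simp [mul_comm]
  · obtain ⟨y, hy, rfl⟩ := hx 0
    simp only [pow_zero, one_mul] at hx ⊢
    exact congrArg Subtype.val (hO.eq_zero_of_dvd hπ (x := ⟨y, hy⟩)
      fun n => coe_mem_powSubmodule.1 (hx n))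
  · obtain ⟨x, hx⟩ := hO.exists_limit hπ (fun n => ⟨f n, hf n⟩)
      fun n => coe_mem_powSubmodule.1 (h n)
    exact ⟨x, x.2, fun n => coe_mem_powSubmodule.2 (hx n)⟩

theorem mem_powSubmodule_zero {O : ValuationSubring F} {ϖ x : F} :
    x ∈ powSubmodule O ϖ 0 ↔ x ∈ O := by
  simp [mem_powSubmodule]

theorem powSubmodule_mul_mem {O : ValuationSubring F} {ϖ x y : F} {m n : ℕ}
    (hx : x ∈ powSubmodule O ϖ m) (hy : y ∈ powSubmodule O ϖ n) :
    x * y ∈ powSubmodule O ϖ (m + n) := by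
  obtain ⟨a, ha, rfl⟩ := hx
  obtain ⟨b, hb, rfl⟩ := hy
  exact ⟨a * b, mul_mem ha hb, by ring⟩

theorem powSubmodule_mul_mem_left {O : ValuationSubring F} {ϖ x y : F} {n : ℕ}
    (hx : x ∈ powSubmodule O ϖ n) (hy : y ∈ O) : x * y ∈ powSubmodule O ϖ n :=
  powSubmodule_mul_mem (n := 0) hx (mem_powSubmodule_zero.2 hy)

theorem powSubmodule_mul_mem_right {O : ValuationSubring F} {ϖ x y : F} {n : ℕ}
    (hx : x ∈ O) (hy : y ∈ powSubmodule O ϖ n) : x * y ∈ powSubmodule O ϖ n := by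
  rw [mul_comm]; exact powSubmodule_mul_mem_left hy hx

theorem pow_mem_powSubmodule {O : ValuationSubring F} {ϖ x : F} {n : ℕ}
    (hx : x ∈ powSubmodule O ϖ 1) : x ^ n ∈ powSubmodule O ϖ n := by
  obtain ⟨a, ha, rfl⟩ := hx
  exact ⟨a ^ n, pow_mem ha n, by ring⟩

theorem self_pow_mem_powSubmodule (O : ValuationSubring F) (ϖ : F) (n : ℕ) :
    ϖ ^ n ∈ powSubmodule O ϖ n := ⟨1, one_mem O, by ring⟩

theorem mem_powSubmodule_of_valuation_le {O : ValuationSubring F} {ϖ x : F} {n : ℕ}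
    (hx : O.valuation x ≤ O.valuation (ϖ ^ n)) : x ∈ powSubmodule O ϖ n := by
  rw [ValuationSubring.valuation_le_iff] at hx
  obtain ⟨a, rfl⟩ := hx
  exact ⟨a, a.2, mul_comm _ _⟩

namespace IsUniformizer

variable {O : ValuationSubring F} {ϖ : F} (h : IsUniformizer O ϖ)
include h

theorem powSubmodule_anti {m n : ℕ} (hmn : m ≤ n) : powSubmodule O ϖ n ≤ powSubmodule O ϖ m := by
  rintro _ ⟨y, hy, rfl⟩
  refine ⟨ϖ ^ (n - m) * y, mul_mem (pow_mem h.mem _) hy, ?_⟩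
  rw [← mul_assoc, ← pow_add, Nat.add_sub_cancel' hmn]

theorem powSubmodule_le {n : ℕ} {x : F} (hx : x ∈ powSubmodule O ϖ n) : x ∈ O :=
  mem_powSubmodule_zero.1 (h.powSubmodule_anti (Nat.zero_le n) hx)

theorem mul_mem_powSubmodule_add_iff {m n : ℕ} {x : F} :
    ϖ ^ m * x ∈ powSubmodule O ϖ (m + n) ↔ x ∈ powSubmodule O ϖ n := by
  constructor
  · rintro ⟨y, hy, hxy⟩
    refine ⟨y, hy, mul_left_cancel₀ (pow_ne_zero m h.ne_zero) ?_⟩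
    rw [hxy]; ring
  · exact powSubmodule_mul_mem (self_pow_mem_powSubmodule O ϖ m)

theorem zpow_mem_iff {m : ℤ} : ϖ ^ m ∈ O ↔ 0 ≤ m := by
  constructor
  · intro hm
    by_contra! hneg
    apply h.inv_notMem
    obtain ⟨n, hn⟩ := Int.eq_ofNat_of_zero_le (a := -m - 1) (by omega)
    have : ϖ⁻¹ = ϖ ^ m * ϖ ^ n := by
      rw [← zpow_natCast, ← zpow_add₀ h.ne_zero, ← zpow_neg_one]
      congr 1
      omega
    rw [this]
    exact mul_mem hm (pow_mem h.mem _)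
  · intro hm
    obtain ⟨n, rfl⟩ := Int.eq_ofNat_of_zero_le hm
    simpa using pow_mem h.mem n

theorem one_notMem : (1 : F) ∉ powSubmodule O ϖ 1 := by
  rintro ⟨y, hy, hy1⟩
  apply h.inv_notMem
  rw [pow_one] at hy1
  rwa [← eq_inv_of_mul_eq_one_right hy1.symm]

theorem inv_mem {x : F} (hx : x ∈ O) (hx1 : x ∉ powSubmodule O ϖ 1) : x⁻¹ ∈ O := by
  have hx0 : x ≠ 0 := fun h0 => hx1 (h0 ▸ zero_mem _)
  obtain ⟨m, u, hu, hu', hu0, rfl⟩ := h.decomp x hx0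
  have hm : 0 ≤ m := by
    rw [← h.zpow_mem_iff]
    have := mul_mem hx hu'
    rwa [mul_inv_cancel_right₀ hu0] at this
  obtain ⟨n, rfl⟩ := Int.eq_ofNat_of_zero_le hm
  rcases Nat.eq_zero_or_pos n with rfl | hn
  · simpa using hu'
  · exact absurd (h.powSubmodule_anti hn ⟨u, hu, by simp⟩) hx1

theorem mul_mem_iff {x y : F} (hx : x ∈ O) (hy : y ∈ O) :
    x * y ∈ powSubmodule O ϖ 1 ↔ x ∈ powSubmodule O ϖ 1 ∨ y ∈ powSubmodule O ϖ 1 := by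
  constructor
  · intro hxy
    by_contra! hn
    have := powSubmodule_mul_mem_left hxy (mul_mem (h.inv_mem hx hn.1) (h.inv_mem hy hn.2))
    have hx0 : x ≠ 0 := fun h0 => hn.1 (h0 ▸ zero_mem _)
    have hy0 : y ≠ 0 := fun h0 => hn.2 (h0 ▸ zero_mem _)
    rw [mul_mul_mul_comm, mul_inv_cancel₀ hx0, mul_inv_cancel₀ hy0, one_mul] at this
    exact h.one_notMem this
  · rintro (h1 | h1)
    · exact powSubmodule_mul_mem_left h1 hy
    · exact powSubmodule_mul_mem_right hx h1

theorem exists_pow_mul_mem (x : F) : ∃ n : ℕ, ϖ ^ n * x ∈ O := by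
  by_cases hx : x = 0
  · exact ⟨0, by simp [hx]⟩
  obtain ⟨m, u, hu, -, -, rfl⟩ := h.decomp x hx
  refine ⟨m.natAbs, ?_⟩
  rw [← mul_assoc, ← zpow_natCast, ← zpow_add₀ h.ne_zero]
  exact mul_mem (h.zpow_mem_iff.2 (by omega)) hu

theorem notMem_powSubmodule_of_inv_mem {x : F} (hx0 : x ≠ 0) (hx : x⁻¹ ∈ O) :
    x ∉ powSubmodule O ϖ 1 := fun hx1 => by
  have := powSubmodule_mul_mem_left hx1 hx
  rw [mul_inv_cancel₀ hx0] at this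
  exact h.one_notMem this

theorem valuation_lt_one : O.valuation ϖ < 1 := by
  refine lt_of_le_of_ne ((O.valuation_le_one_iff _).2 h.mem) fun h1 => h.inv_notMem ?_
  rw [← O.valuation_le_one_iff, map_inv₀, h1, inv_one]

theorem exists_valuation_lt {γ : O.ValueGroup} (hγ : γ ≠ 0) :
    ∃ n : ℕ, ∀ x ∈ powSubmodule O ϖ n, O.valuation x < γ := by
  obtain ⟨a, rfl⟩ := O.valuation_surjective γ
  have ha : a ≠ 0 := by rintro rfl; simp at hγ
  obtain ⟨n, hn⟩ := h.exists_pow_mul_mem a⁻¹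
  refine ⟨n + 1, ?_⟩
  rintro _ ⟨y, hy, rfl⟩
  have h1 : O.valuation (ϖ * (ϖ ^ n * a⁻¹ * y)) < 1 := by
    rw [map_mul]
    calc _ ≤ O.valuation ϖ * 1 := mul_le_mul' le_rfl ((O.valuation_le_one_iff _).2 (mul_mem hn hy))
      _ < 1 := by rw [mul_one]; exact h.valuation_lt_one
  have : ϖ ^ (n + 1) * y = ϖ * (ϖ ^ n * a⁻¹ * y) * a := by
    field_simp
    ring
  rw [this, map_mul]
  calc _ < 1 * O.valuation a := (mul_lt_mul_iff_left₀ (zero_lt_iff.2 hγ)).2 h1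
    _ = _ := one_mul _

theorem mem_padicSubfield {x : F}
    (hx : ∀ n : ℕ, ∃ q ∈ (⊥ : Subfield F), x - q ∈ powSubmodule O ϖ n) :
    x ∈ padicSubfield O := by
  rw [TwoDimLocal.mem_padicSubfield]
  intro γ hγ
  obtain ⟨n, hn⟩ := h.exists_valuation_lt hγ
  obtain ⟨q, hq, hqx⟩ := hx n
  exact ⟨q, hq, hn _ (by rw [← neg_sub]; exact neg_mem hqx)⟩

theorem exists_rat {x : F} (hx : x ∈ padicSubfield O) (n : ℕ) :
    ∃ q ∈ (⊥ : Subfield F), x - q ∈ powSubmodule O ϖ n := by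
  obtain ⟨q, hq, h1⟩ := (TwoDimLocal.mem_padicSubfield O x).1 hx (O.valuation (ϖ ^ n))
    ((O.valuation.ne_zero_iff).2 (pow_ne_zero n h.ne_zero))
  refine ⟨q, hq, mem_powSubmodule_of_valuation_le ?_⟩
  rw [Valuation.map_sub_swap]
  exact h1.le

open Classical in
-- Sorting the `p`-adic expansion of `x` by its digits gives `x = ∑ w_a a` over `a ∈ S`, where `w_a`
-- is a sum of powers of `p` and so lies in the closure of `ℚ`. Thus `R` spans a finite-dimensional
-- space over that closure, stable under multiplication by `x`, and `x` is integral over it.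
theorem mem_constantField_of_finite {p : ℕ} (hp : (p : F) ∈ powSubmodule O ϖ 1) {R : Subring F}
    (hR : ∀ x ∈ R, x ∈ O) {S : Finset F} (hS : ∀ s ∈ S, s ∈ R)
    (hRS : ∀ x ∈ R, ∃ s ∈ S, ∃ y ∈ R, x = s + p * y) {x : F} (hx : x ∈ R) :
    x ∈ constantField O := by
  have hpn : ∀ n : ℕ, (p : F) ^ n ∈ powSubmodule O ϖ n := fun n => pow_mem_powSubmodule hp
  have hspan : ∀ x ∈ R, x ∈ Submodule.span (padicSubfield O) (S : Set F) := by
    intro x hx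
    choose! s hs y hy hxy using hRS
    let z : ℕ → F := fun n => y^[n] x
    have hz : ∀ n, z n ∈ R := fun n => by
      induction n with
      | zero => exact hx
      | succ n ih => simp only [z, Function.iterate_succ_apply']; exact hy _ ih
    have hzs : ∀ n, z n = s (z n) + p * z (n + 1) := fun n => by
      conv_lhs => rw [hxy _ (hz n)]
      simp only [z, Function.iterate_succ_apply']
    have hpart : ∀ n, x = ∑ j ∈ Finset.range n, s (z j) * (p : F) ^ j + p ^ n * z n := by
      intro n
      induction n with
      | zero => simp [z]
      | succ n ih =>
        rw [Finset.sum_range_succ]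
        conv_lhs => rw [ih, hzs n]
        ring
    -- The partial sums of `w_a`: the powers `p ^ j` at which the digit `s (z j)` equals `a`.
    let f : F → ℕ → F := fun a n => ∑ j ∈ Finset.range n, if s (z j) = a then (p : F) ^ j else 0
    have hfb : ∀ a n, f a n ∈ (⊥ : Subfield F) := fun a n =>
      sum_mem fun j _ => by split_ifs; exacts [pow_mem (natCast_mem _ _) _, zero_mem _]
    have hfO : ∀ a n, f a n ∈ O := fun a n =>
      sum_mem fun j _ => by split_ifs; exacts [pow_mem (natCast_mem _ _) _, zero_mem _]
    have hlim : ∀ a, ∃ w ∈ O, ∀ n, w - f a n ∈ powSubmodule O ϖ n := fun a => by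
      refine h.complete (f a) (hfO a) fun n => ?_
      simp only [f, Finset.sum_range_succ, add_sub_cancel_left]
      split_ifs
      exacts [hpn n, zero_mem _]
    choose w hwO hw using hlim
    have hwp : ∀ a, w a ∈ padicSubfield O := fun a =>
      h.mem_padicSubfield fun n => ⟨f a n, hfb a n, hw a n⟩
    have hxw : x = ∑ a ∈ S, w a * a := by
      rw [← sub_eq_zero]
      refine h.haus _ fun n => ?_
      have h1 : ∑ a ∈ S, f a n * a = ∑ j ∈ Finset.range n, s (z j) * (p : F) ^ j := by
        simp only [f, Finset.sum_mul]
        rw [Finset.sum_comm]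
        refine Finset.sum_congr rfl fun j _ => ?_
        simp only [ite_mul, zero_mul]
        rw [Finset.sum_ite_eq, if_pos (hs _ (hz j)), mul_comm]
      have h2 : x - ∑ a ∈ S, w a * a = p ^ n * z n - ∑ a ∈ S, (w a - f a n) * a := by
        simp only [sub_mul, Finset.sum_sub_distrib]
        rw [h1]
        conv_lhs => rw [hpart n]
        ring
      rw [h2]
      refine sub_mem (powSubmodule_mul_mem_left (hpn n) (hR _ (hz n))) (sum_mem fun a ha => ?_)
      exact powSubmodule_mul_mem_left (hw a n) (hR _ (hS a ha))
    rw [hxw]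
    refine sum_mem fun a ha => ?_
    exact Submodule.smul_mem _ (⟨w a, hwp a⟩ : padicSubfield O) (Submodule.subset_span ha)
  -- Spanned by `R` instead of `S`, so that stability under multiplication by `x` is immediate.
  let N : Submodule (padicSubfield O) F := Submodule.span _ (R : Set F)
  have hNle : N ≤ Submodule.span (padicSubfield O) (S : Set F) := Submodule.span_le.2 hspan
  have hNfg : N.FG := by
    have : FiniteDimensional (padicSubfield O) (Submodule.span (padicSubfield O) (S : Set F)) :=
      FiniteDimensional.span_finset _ S
    have h1 := Submodule.finiteDimensional_of_le hNle
    exact (Submodule.fg_iff_finiteDimensional _).2 h1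
  have hN : N ≠ ⊥ := fun hb => by
    have h1 : (1 : F) ∈ N := Submodule.subset_span R.one_mem
    rw [hb, Submodule.mem_bot] at h1
    exact one_ne_zero h1
  have hint : IsIntegral (padicSubfield O) x := by
    refine isIntegral_of_smul_mem_submodule N hN hNfg x fun n hn => ?_
    induction hn using Submodule.span_induction with
    | mem y hy => exact Submodule.subset_span (R.mul_mem hx hy)
    | zero => simp
    | add a b _ _ ha hb => rw [smul_add]; exact add_mem ha hb
    | smul c y _ hy => rw [smul_comm]; exact Submodule.smul_mem _ _ hy
  exact (mem_algebraicClosure_iff' (F := padicSubfield O) (E := F)).2 hint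

/-- As `mem_constantField_of_finite`, with an element `π` some power of which is divisible by `p`
in place of `p`. -/
theorem mem_constantField_of_finite_pow {p : ℕ} (hp : (p : F) ∈ powSubmodule O ϖ 1)
    {R : Subring F} (hR : ∀ x ∈ R, x ∈ O) {S : Finset F} (hS : ∀ s ∈ S, s ∈ R) {π : F}
    (hπ : π ∈ R) (hRS : ∀ x ∈ R, ∃ s ∈ S, ∃ y ∈ R, x = s + π * y) {e : ℕ}
    (he : ∃ r ∈ R, π ^ e = p * r) {x : F} (hx : x ∈ R) : x ∈ constantField O := by
  classical
  obtain ⟨r, hr, her⟩ := he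
  -- Sums of `n` digits in base `π` represent `R` modulo `π ^ n`; for `n = e` this is finer than
  -- modulo `p`.
  have : ∀ n : ℕ, ∃ T : Finset F, (∀ s ∈ T, s ∈ R) ∧
      ∀ x ∈ R, ∃ s ∈ T, ∃ y ∈ R, x = s + π ^ n * y := by
    intro n
    induction n with
    | zero => exact ⟨{0}, by simp [R.zero_mem], fun x hx => ⟨0, by simp, x, hx, by simp⟩⟩
    | succ n ih =>
      obtain ⟨T, hT, hRT⟩ := ih
      refine ⟨Finset.image₂ (fun a b => a + π ^ n * b) T S, ?_, fun x hx => ?_⟩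
      · intro s hs
        obtain ⟨a, ha, b, hb, rfl⟩ := Finset.mem_image₂.1 hs
        exact R.add_mem (hT a ha) (R.mul_mem (R.pow_mem hπ n) (hS b hb))
      · obtain ⟨a, ha, y, hy, rfl⟩ := hRT x hx
        obtain ⟨b, hb, z, hz, rfl⟩ := hRS y hy
        exact ⟨_, Finset.mem_image₂_of_mem ha hb, z, hz, by ring⟩
  obtain ⟨T, hT, hRT⟩ := this e
  refine h.mem_constantField_of_finite hp hR hT (fun x hx => ?_) hx
  obtain ⟨s, hs, y, hy, rfl⟩ := hRT x hx
  exact ⟨s, hs, r * y, R.mul_mem hr hy, by rw [her, mul_assoc]⟩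

end IsUniformizer

end General

/-! ### The constant subfield: finite residue field, closedness, local subfields -/

section Setting

variable {L : Type u} [Field L]

/-- A uniformizer `ϖ` of `O` lying in a subfield `k` which is closed and has finite residue field
of characteristic `p`, in a field of characteristic zero. -/
structure Setting (O : ValuationSubring L) (k : Subfield L) (ϖ : L) (p : ℕ) : Prop
    extends IsUniformizer O ϖ where
  complete_dvr : IsCompleteDVR O
  mem_k : ϖ ∈ k
  prime : p.Prime
  p_mem : (p : L) ∈ powSubmodule O ϖ 1
  charZero : CharZero L
  closed : ∀ x ∈ O, (∀ n, ∃ a ∈ k, x - a ∈ powSubmodule O ϖ n) → x ∈ k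
  finite : ∃ S : Finset L, (∀ s ∈ S, s ∈ k ∧ s ∈ O) ∧
    ∀ a ∈ k, a ∈ O → ∃ s ∈ S, a - s ∈ powSubmodule O ϖ 1

/-- Bézout for the reduced fraction, `u * num + v * den = 1`, gives `den⁻¹ = u * q + v`, which is
integral. -/
theorem exists_int_div {O : ValuationSubring L} [CharZero L] {q : L} (hq : q ∈ (⊥ : Subfield L))
    (hqO : q ∈ O) : ∃ a b : ℤ, (b : L) ≠ 0 ∧ (b : L)⁻¹ ∈ O ∧ q = a / b := by
  rw [Subfield.bot_eq_of_charZero] at hq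
  obtain ⟨r, rfl⟩ := hq
  have hd : (r.den : L) ≠ 0 := by exact_mod_cast r.den_nz
  have hr : (algebraMap ℚ L r) = r.num / r.den := by
    rw [eq_ratCast]; exact Rat.cast_def r
  refine ⟨r.num, r.den, by exact_mod_cast hd, ?_, by rw [hr]; simp⟩
  have hco : IsCoprime r.num (r.den : ℤ) := by
    rw [Int.isCoprime_iff_gcd_eq_one]
    exact r.reduced
  obtain ⟨u, v, huv⟩ := hco
  have huv' : (u : L) * r.num + v * r.den = 1 := by exact_mod_cast congrArg (Int.cast (R := L)) huv
  have : (((r.den : ℕ) : ℤ) : L)⁻¹ = u * (algebraMap ℚ L r) + v := by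
    rw [hr]
    push_cast
    field_simp
    linear_combination -huv'
  rw [this]
  exact add_mem (mul_mem (intCast_mem _ _) hqO) (intCast_mem _ _)

/-- Dividing an annihilating polynomial by a coefficient of largest value leaves a coefficient `1`,
so that the reduction modulo the maximal ideal is nonzero. -/
theorem exists_primitive_polynomial (O : ValuationSubring L) {x : L}
    (hx : x ∈ constantField O) : ∃ f : Polynomial (padicSubfield O),
      (∀ i, (f.coeff i : L) ∈ O) ∧ (∃ i, f.coeff i = 1) ∧ Polynomial.aeval x f = 0 := by
  obtain ⟨f, hf0, hf⟩ : IsAlgebraic (padicSubfield O) x :=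
    (mem_algebraicClosure_iff (F := padicSubfield O) (E := L)).1 hx
  obtain ⟨i, hi, hmax⟩ := Finset.exists_max_image f.support
    (fun i => O.valuation (f.coeff i : L)) (Polynomial.support_nonempty.2 hf0)
  have hi0 : f.coeff i ≠ 0 := Polynomial.mem_support_iff.1 hi
  refine ⟨Polynomial.C (f.coeff i)⁻¹ * f, fun j => ?_, ⟨i, ?_⟩, ?_⟩
  · rw [Polynomial.coeff_C_mul, ← O.valuation_le_one_iff]
    have hle : O.valuation (f.coeff j : L) ≤ O.valuation (f.coeff i : L) := by
      by_cases hj : j ∈ f.support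
      · exact hmax j hj
      · rw [Polynomial.notMem_support_iff.1 hj]; simp
    have hv : O.valuation (f.coeff i : L) ≠ 0 := by
      rw [Valuation.ne_zero_iff]
      exact fun h => hi0 (Subtype.ext h)
    push_cast
    rw [map_mul, map_inv₀, inv_mul_le_iff₀ (zero_lt_iff.2 hv), mul_one]
    exact hle
  · rw [Polynomial.coeff_C_mul, inv_mul_cancel₀ hi0]
  · simp [hf]

/-- Such elements lie in the integrally closed ring `A`. The difference of two distinct ones is a
unit of `A`, its inverse being algebraic too, so they embed in the finite residue field. -/
theorem finite_integral_of_isLocalField {E : Type u} [Field E] (hE : IsLocalField E) (p : ℕ)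
    [Fact p.Prime] [CharP E p] [Algebra (ZMod p) E] :
    {x : E | IsIntegral (ZMod p) x}.Finite := by
  obtain ⟨A, hA⟩ := hE
  have := hA.finite
  have hmem : ∀ x : E, IsIntegral (ZMod p) x → x ∈ A := by
    intro x hx
    have : CharP A p := (algebraMap A E).charP Subtype.val_injective p
    obtain ⟨f, hf, hfx⟩ := hx
    have h1 : IsIntegral A x := by
      refine ⟨f.map (ZMod.castHom (dvd_refl p) A), hf.map _, ?_⟩
      rw [Polynomial.eval₂_map, ← hfx]
      congr 1
      exact Subsingleton.elim _ _
    obtain ⟨y, rfl⟩ := IsIntegrallyClosed.isIntegral_iff.1 h1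
    exact y.2
  have hinj : Function.Injective (fun x : {x : E | IsIntegral (ZMod p) x} =>
      IsLocalRing.residue A ⟨x, hmem x x.2⟩) := by
    intro x y hxy
    by_contra hne
    have hd : (x - y : E) ≠ 0 := sub_ne_zero.2 fun h => hne (Subtype.ext h)
    have hint : IsIntegral (ZMod p) (x - y : E) := x.2.sub y.2
    have hinv : IsIntegral (ZMod p) (x - y : E)⁻¹ := by
      rw [← isAlgebraic_iff_isIntegral] at hint ⊢
      exact hint.inv
    simp only [← sub_eq_zero (b := IsLocalRing.residue A _)] at hxy
    rw [← map_sub, IsLocalRing.residue_eq_zero_iff] at hxy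
    refine (IsLocalRing.mem_maximalIdeal _).1 hxy ?_
    exact IsUnit.of_mul_eq_one ⟨_, hmem _ hinv⟩ (Subtype.ext (mul_inv_cancel₀ hd))
  exact Set.finite_coe_iff.1 (Finite.of_injective _ hinj)

theorem IsUniformizer.mem_powSubmodule_one_iff {O : ValuationSubring L} {ϖ : L}
    (h : IsUniformizer O ϖ) (x : O) :
    (x : L) ∈ powSubmodule O ϖ 1 ↔ IsLocalRing.residue O x = 0 := by
  rw [IsLocalRing.residue_eq_zero_iff, ValuationSubring.valuation_lt_one_iff]
  constructor
  · rintro ⟨y, hy, hx⟩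
    rw [hx, pow_one, map_mul]
    calc _ ≤ O.valuation ϖ * 1 := mul_le_mul' le_rfl ((O.valuation_le_one_iff _).2 hy)
      _ < 1 := by rw [mul_one]; exact h.valuation_lt_one
  · intro hx
    by_contra hn
    have := (O.valuation_le_one_iff _).2 (h.inv_mem x.2 hn)
    have hx0 : (x : L) ≠ 0 := fun h0 => hn (h0 ▸ zero_mem _)
    rw [map_inv₀, inv_le_one₀ (zero_lt_iff.2 ((O.valuation.ne_zero_iff).2 hx0))] at this
    exact absurd hx (not_lt.2 this)

/-- Reduce a primitive annihilating polynomial: its coefficients are limits of rationals, so their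
residues lie in the prime field. -/
theorem IsUniformizer.isIntegral_residue {O : ValuationSubring L} {ϖ : L}
    (h : IsUniformizer O ϖ) [CharZero L] (p : ℕ) [Fact p.Prime]
    [Algebra (ZMod p) (IsLocalRing.ResidueField O)] (a : O)
    (ha : (a : L) ∈ constantField O) : IsIntegral (ZMod p) (IsLocalRing.residue O a) := by
  obtain ⟨f, hfO, ⟨i₀, hi₀⟩, hf⟩ := exists_primitive_polynomial O ha
  have hz : ∀ i, ∃ z : ZMod p, algebraMap (ZMod p) (IsLocalRing.ResidueField O) z =
      IsLocalRing.residue O ⟨f.coeff i, hfO i⟩ := by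
    intro i
    obtain ⟨q, hq, hqi⟩ := h.exists_rat (f.coeff i).2 1
    have hqO : q ∈ O := by
      have := sub_mem (hfO i) (h.powSubmodule_le hqi)
      rwa [sub_sub_cancel] at this
    obtain ⟨m, n, hn0, hn, rfl⟩ := exists_int_div hq hqO
    refine ⟨m / n, ?_⟩
    have h1 : IsLocalRing.residue O ⟨f.coeff i, hfO i⟩ = IsLocalRing.residue O ⟨(m : L) / n, hqO⟩ := by
      rw [← sub_eq_zero, ← map_sub]
      exact (h.mem_powSubmodule_one_iff _).1 hqi
    have hnu : IsLocalRing.residue O (n : O) ≠ 0 := by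
      rw [Ne, ← h.mem_powSubmodule_one_iff]
      have := h.notMem_powSubmodule_of_inv_mem hn0 hn
      simpa using this
    rw [h1, map_div₀, map_intCast, map_intCast, div_eq_iff (by simpa using hnu)]
    rw [← map_intCast (IsLocalRing.residue O), ← map_intCast (IsLocalRing.residue O), ← map_mul]
    congr 1
    refine Subtype.ext ?_
    push_cast
    field_simp
  choose z hz using hz
  let g : Polynomial (ZMod p) := ∑ i ∈ f.support, Polynomial.C (z i) * Polynomial.X ^ i
  have hgc : g.coeff i₀ = z i₀ := by
    have hi : i₀ ∈ f.support := by rw [Polynomial.mem_support_iff, hi₀]; exact one_ne_zero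
    simp [g, Polynomial.coeff_X_pow, hi₀]
  have hz1 : z i₀ ≠ 0 := by
    intro h0
    have := hz i₀
    rw [h0, map_zero, eq_comm] at this
    have h2 : (⟨f.coeff i₀, hfO i₀⟩ : O) = 1 := Subtype.ext (by simp [hi₀])
    rw [h2, map_one] at this
    exact one_ne_zero this
  rw [← isAlgebraic_iff_isIntegral]
  refine ⟨g, fun h0 => hz1 (by rw [← hgc, h0, Polynomial.coeff_zero]), ?_⟩
  have : Polynomial.aeval (IsLocalRing.residue O a) g =
      IsLocalRing.residue O (∑ i ∈ f.support, ⟨f.coeff i, hfO i⟩ * a ^ i) := by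
    simp [g, hz]
  rw [this]
  have h0 : (∑ i ∈ f.support, (⟨f.coeff i, hfO i⟩ : O) * a ^ i) = 0 := by
    refine Subtype.ext ?_
    rw [Polynomial.aeval_def, Polynomial.eval₂_eq_sum, Polynomial.sum] at hf
    push_cast
    exact hf
  rw [h0, map_zero]

/-- This is the use of `e(L/k) = 1`: some constant has the value of a uniformizer and differs from
it by a unit. -/
theorem IsMixedTwoDimLocalField.exists_irreducible {O : ValuationSubring L}
    (hL : IsMixedTwoDimLocalField O) (hstd : IsStandard O) :
    ∃ π : O, Irreducible π ∧ (π : L) ∈ constantField O := by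
  have := hL.dvr
  obtain ⟨π, hπ⟩ := IsDiscreteValuationRing.exists_irreducible O
  have h0 : (π : L) ≠ 0 := fun h => hπ.ne_zero (Subtype.ext h)
  have htop := Subgroup.index_eq_one.1 hstd
  have hmem : Units.map (O.valuation : L →* O.ValueGroup) (Units.mk0 (π : L) h0) ∈
      ((Units.map ((constantField O).subtype : constantField O →* L)).range.map
    (Units.map (O.valuation : L →* O.ValueGroup))) := by rw [htop]; trivial
  obtain ⟨_, ⟨c, rfl⟩, hc⟩ := hmem
  have hc' : O.valuation ((c : constantField O) : L) = O.valuation (π : L) :=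
    congrArg Units.val hc
  rw [ValuationSubring.valuation_eq_iff] at hc'
  obtain ⟨u, hu⟩ := hc'
  refine ⟨u * π, (irreducible_units_mul u).2 hπ, ?_⟩
  have : (((u : O) * π : O) : L) = ((c : constantField O) : L) := by simpa using hu
  rw [this]
  exact (c : constantField O).2

open Classical in
-- The delicate point is that `k` is closed. The closure `R` of `k ∩ O` in `O` has the same finitely
-- many residues as `k ∩ O`, so `mem_constantField_of_finite_pow` puts it inside `k`.
theorem IsMixedTwoDimLocalField.exists_setting {O : ValuationSubring L}
    (hL : IsMixedTwoDimLocalField O) (hstd : IsStandard O) :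
    ∃ (ϖ : L) (p : ℕ), Setting O (constantField O) ϖ p := by
  obtain ⟨π, hπ, hπk⟩ := hL.exists_irreducible hstd
  have h := hL.toIsCompleteDVR.isUniformizer hπ
  have := hL.charZero
  obtain ⟨p, hp, hchar⟩ := hL.residueChar
  have : Fact p.Prime := ⟨hp⟩
  let _ : Algebra (ZMod p) (IsLocalRing.ResidueField O) := ZMod.algebra _ p
  have hpm : (p : L) ∈ powSubmodule O (π : L) 1 := by
    have := (h.mem_powSubmodule_one_iff (p : O)).2 (by simp)
    simpa using this
  obtain ⟨S, hS, hkS⟩ : ∃ S : Finset L, (∀ s ∈ S, s ∈ constantField O ∧ s ∈ O) ∧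
    ∀ a ∈ constantField O, a ∈ O → ∃ s ∈ S, a - s ∈ powSubmodule O (π : L) 1 := by
    have hfin : {y | ∃ a : O, (a : L) ∈ constantField O ∧ IsLocalRing.residue O a = y}.Finite := by
      refine (finite_integral_of_isLocalField hL.residue p).subset ?_
      rintro _ ⟨a, ha, rfl⟩
      exact h.isIntegral_residue p a ha
    choose! r hr hry using fun (y : IsLocalRing.ResidueField O)
      (hy : ∃ a : O, (a : L) ∈ constantField O ∧ IsLocalRing.residue O a = y) => hy
    refine ⟨hfin.toFinset.image fun y => (r y : L), ?_, ?_⟩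
    · intro s hs
      obtain ⟨y, hy, rfl⟩ := Finset.mem_image.1 hs
      exact ⟨hr y (hfin.mem_toFinset.1 hy), (r y).2⟩
    · intro a ha haO
      have hy : ∃ b : O, (b : L) ∈ constantField O ∧
        IsLocalRing.residue O b = IsLocalRing.residue O ⟨a, haO⟩ := ⟨⟨a, haO⟩, ha, rfl⟩
      refine ⟨_, Finset.mem_image_of_mem _ (hfin.mem_toFinset.2 hy), ?_⟩
      have := (h.mem_powSubmodule_one_iff (⟨a, haO⟩ - r _)).2
        (by rw [map_sub, hry _ hy, sub_self])
      simpa using this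
  refine ⟨π, p, ⟨h, hL.toIsCompleteDVR, hπk, hp, hpm, inferInstance, ?_, ⟨S, hS, hkS⟩⟩⟩
  let R : Subring L :=
    { carrier := {x | x ∈ O ∧ ∀ n, ∃ a ∈ constantField O, x - a ∈ powSubmodule O (π : L) n}
      mul_mem' := by
        rintro x y ⟨hx, hx'⟩ ⟨hy, hy'⟩
        refine ⟨mul_mem hx hy, fun n => ?_⟩
        obtain ⟨a, ha, hxa⟩ := hx' n
        obtain ⟨b, hb, hyb⟩ := hy' n
        refine ⟨a * b, mul_mem ha hb, ?_⟩
        have haO : a ∈ O := by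
          have := sub_mem hx (h.powSubmodule_le hxa)
          rwa [sub_sub_cancel] at this
        have : x * y - a * b = (x - a) * y + a * (y - b) := by ring
        rw [this]
        exact add_mem (powSubmodule_mul_mem_left hxa hy) (powSubmodule_mul_mem_right haO hyb)
      one_mem' := ⟨one_mem O, fun n => ⟨1, one_mem _, by simp⟩⟩
      add_mem' := by
        rintro x y ⟨hx, hx'⟩ ⟨hy, hy'⟩
        refine ⟨add_mem hx hy, fun n => ?_⟩
        obtain ⟨a, ha, hxa⟩ := hx' n
        obtain ⟨b, hb, hyb⟩ := hy' n
        exact ⟨a + b, add_mem ha hb, by rw [add_sub_add_comm]; exact add_mem hxa hyb⟩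
      zero_mem' := ⟨zero_mem O, fun n => ⟨0, zero_mem _, by simp⟩⟩
      neg_mem' := by
        rintro x ⟨hx, hx'⟩
        refine ⟨neg_mem hx, fun n => ?_⟩
        obtain ⟨a, ha, hxa⟩ := hx' n
        exact ⟨-a, neg_mem ha, by rw [← neg_sub']; exact neg_mem hxa⟩ }
  have hkR : ∀ a ∈ constantField O, a ∈ O → a ∈ R := fun a ha haO =>
    ⟨haO, fun n => ⟨a, ha, by simp⟩⟩
  have hp0 : (p : L) ≠ 0 := by exact_mod_cast hp.ne_zero
  obtain ⟨m, u, hu, hu', hu0, hpu⟩ := h.decomp p hp0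
  have hm : 0 ≤ m := by
    rw [← h.zpow_mem_iff]
    have := mul_mem (h.powSubmodule_le hpm) hu'
    rwa [hpu, mul_inv_cancel_right₀ hu0] at this
  obtain ⟨e, rfl⟩ := Int.eq_ofNat_of_zero_le hm
  have huk : u⁻¹ ∈ constantField O := by
    have : u⁻¹ = (π : L) ^ e * (p : L)⁻¹ := by
      rw [hpu]
      have := h.ne_zero
      simp only [zpow_natCast]
      field_simp
    rw [this]
    exact mul_mem (pow_mem hπk _) (inv_mem (natCast_mem _ _))
  intro x hx hx'
  refine h.mem_constantField_of_finite_pow hpm (R := R) (fun x hx => hx.1) (S := S)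
    (fun s hs => hkR s (hS s hs).1 (hS s hs).2) (hkR _ hπk π.2) ?_ (e := e)
    ⟨u⁻¹, hkR _ huk hu', ?_⟩ ⟨hx, hx'⟩
  · rintro x ⟨hx, hx'⟩
    obtain ⟨a, ha, hxa⟩ := hx' 1
    have haO : a ∈ O := by
      have := sub_mem hx (h.powSubmodule_le hxa)
      rwa [sub_sub_cancel] at this
    obtain ⟨s, hs, has⟩ := hkS a ha haO
    have hxs := add_mem hxa has
    rw [sub_add_sub_cancel] at hxs
    obtain ⟨y, hy, hxy⟩ := hxs
    rw [pow_one] at hxy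
    refine ⟨s, hs, y, ⟨hy, fun n => ?_⟩, by rw [← hxy]; ring⟩
    -- The division by `π` costs one degree of precision.
    obtain ⟨b, hb, hxb⟩ := hx' (1 + n)
    refine ⟨(π : L)⁻¹ * (b - s), mul_mem (inv_mem hπk) (sub_mem hb (hS s hs).1), ?_⟩
    rw [← h.mul_mem_powSubmodule_add_iff (m := 1)]
    have : (π : L) ^ 1 * (y - (π : L)⁻¹ * (b - s)) = x - b := by
      have := h.ne_zero
      field_simp
      linear_combination -hxy
    rwa [this]
  · rw [hpu]
    simp [hu0]

/-- The valuation of `L` restricts to a discrete valuation of `K`, nontrivial because `p⁻¹ ∉ O`. By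
uniqueness its ring is `B`, whose residue field is finite and in which `p` is a unit times a power
of `π`; so `mem_constantField_of_finite_pow` applies to `K ∩ O`. -/
theorem Setting.le_constantField {O : ValuationSubring L} {ϖ : L} {p : ℕ}
    (h : Setting O (constantField O) ϖ p) {K : Subfield L} (hK : IsLocalField K) {x : L}
    (hxK : x ∈ K) (hx : x ∈ O) : x ∈ constantField O := by
  classical
  obtain ⟨B, hB⟩ := hK
  have := hB.dvr
  have := hB.finite
  have := h.charZero
  have hp0 : (p : L) ≠ 0 := by exact_mod_cast h.prime.ne_zero
  choose! g u hu hu' hu0 hxu using h.decomp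
  have hgu : ∀ (m : ℤ) (w : L), w ≠ 0 → w ∈ O → w⁻¹ ∈ O → (0 ≤ m ↔ ϖ ^ m * w ∈ O) := by
    intro m w hw0 hw hw'
    rw [← h.zpow_mem_iff]
    refine ⟨fun hm => mul_mem hm hw, fun hm => ?_⟩
    have := mul_mem hm hw'
    rwa [mul_inv_cancel_right₀ hw0] at this
  have hle : ∀ x : L, x ≠ 0 → ∀ (m : ℤ) (w : L), w ≠ 0 → w ∈ O → w⁻¹ ∈ O → x = ϖ ^ m * w →
      g x = m := by
    intro x hx m w hw0 hw hw' hxw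
    have h1 : ϖ ^ (g x - m) * (u x / w) = 1 := by
      rw [zpow_sub₀ h.ne_zero]
      have h2 := hxu x hx
      have h3 := zpow_ne_zero m h.ne_zero
      field_simp
      rw [← h2, hxw]
    have h2 : ϖ ^ (m - g x) * (w / u x) = 1 := by
      rw [← inv_inv (ϖ ^ (m - g x) * (w / u x)), mul_inv, ← zpow_neg, neg_sub, inv_div, h1, inv_one]
    have h3 := (hgu _ (u x / w) (div_ne_zero (hu0 x hx) hw0)
      (by rw [div_eq_mul_inv]; exact mul_mem (hu x hx) hw')
      (by rw [inv_div, div_eq_mul_inv]; exact mul_mem hw (hu' x hx))).2 (h1 ▸ one_mem O)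
    have h4 := (hgu _ (w / u x) (div_ne_zero hw0 (hu0 x hx))
      (by rw [div_eq_mul_inv]; exact mul_mem hw (hu' x hx))
      (by rw [inv_div, div_eq_mul_inv]; exact mul_mem (hu x hx) hw')).2 (h2 ▸ one_mem O)
    omega
  have key := hB.toIsCompleteDVR.toSubring_eq (fun x : K => g (x : L)) (fun x y hx hy => by
      have hx0 : (x : L) ≠ 0 := fun h => hx (Subtype.ext h)
      have hy0 : (y : L) ≠ 0 := fun h => hy (Subtype.ext h)
      refine hle _ (mul_ne_zero hx0 hy0) _ (u x * u y) (mul_ne_zero (hu0 _ hx0) (hu0 _ hy0))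
        (mul_mem (hu _ hx0) (hu _ hy0)) (by rw [mul_inv]; exact mul_mem (hu' _ hx0) (hu' _ hy0)) ?_
      conv_lhs => rw [hxu _ hx0, hxu _ hy0]
      rw [zpow_add₀ h.ne_zero]
      ring) (O.toSubring.comap K.subtype) (fun x hx => by
      have hx0 : (x : L) ≠ 0 := fun h => hx (Subtype.ext h)
      rw [hgu _ (u x) (hu0 _ hx0) (hu _ hx0) (hu' _ hx0), ← hxu _ hx0]
      rfl) (fun htop => by
      have h1 : (p : K)⁻¹ ∈ O.toSubring.comap K.subtype := htop ▸ trivial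
      have h2 : (p : L)⁻¹ ∈ O := by
        have : K.subtype (p : K)⁻¹ ∈ O.toSubring := h1
        simpa using this
      exact h.notMem_powSubmodule_of_inv_mem hp0 h2 h.p_mem)
  have hBO : ∀ x : K, x ∈ B ↔ (x : L) ∈ O := fun x => by
    rw [← ValuationSubring.mem_toSubring, ← key]
    rfl
  obtain ⟨π, hπ⟩ := IsDiscreteValuationRing.exists_irreducible B
  have := Fintype.ofFinite (IsLocalRing.ResidueField B)
  obtain ⟨r, hr⟩ := (IsLocalRing.residue_surjective (R := B)).hasRightInverse
  let R : Subring L := K.toSubring ⊓ O.toSubring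
  have hBR : ∀ b : B, ((b : K) : L) ∈ R := fun b => ⟨(b : K).2, (hBO _).1 b.2⟩
  have hpB : (p : B) ≠ 0 := by
    intro h0
    apply hp0
    have := congrArg (fun b : B => ((b : K) : L)) h0
    simpa using this
  obtain ⟨e, w, hew⟩ := IsDiscreteValuationRing.eq_unit_mul_pow_irreducible hpB hπ
  refine h.mem_constantField_of_finite_pow h.p_mem (R := R) (fun x hx => hx.2)
    (S := Finset.univ.image fun y => ((r y : K) : L)) ?_ (hBR π) ?_ (e := e)
    ⟨((((w⁻¹ : Bˣ) : B) : K) : L), hBR _, ?_⟩ ⟨hxK, hx⟩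
  · intro s hs
    obtain ⟨y, -, rfl⟩ := Finset.mem_image.1 hs
    exact hBR _
  · rintro x ⟨hxK, hxO⟩
    let b : B := ⟨⟨x, hxK⟩, (hBO _).2 hxO⟩
    have hb : b - r (IsLocalRing.residue B b) ∈ IsLocalRing.maximalIdeal B := by
      rw [← IsLocalRing.residue_eq_zero_iff, map_sub, hr, sub_self]
    rw [hπ.maximalIdeal_eq, Ideal.mem_span_singleton] at hb
    obtain ⟨c, hc⟩ := hb
    refine ⟨_, Finset.mem_image_of_mem _ (Finset.mem_univ (IsLocalRing.residue B b)), _, hBR c, ?_⟩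
    have := congrArg (fun b : B => ((b : K) : L)) (sub_eq_iff_eq_add'.1 hc)
    simpa using this
  · have h1 : π ^ e = (p : B) * ((w⁻¹ : Bˣ) : B) := by
      rw [hew, mul_comm, Units.inv_mul_cancel_left]
    have := congrArg (fun b : B => ((b : K) : L)) h1
    simpa using this

end Setting

/-! ### Convergence of the sums defining products of series -/

section Sums

variable {F : Type u} [Field F]

/-- The content is summability, without which `tsum` would be the default value `0`. -/
theorem IsUniformizer.tsum_sub_mem {A : ValuationSubring F} {ϖ : F} (h : IsUniformizer A ϖ)
    (f : ℤ → F) (hf : ∀ n, ∃ S : Finset ℤ, ∀ r ∉ S, f r ∈ powSubmodule A ϖ n) {n : ℕ}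
    {S : Finset ℤ} (hS : ∀ r ∉ S, f r ∈ powSubmodule A ϖ n) :
    letI := valued A
    (∑' r, f r) - ∑ r ∈ S, f r ∈ powSubmodule A ϖ n := by
  let := valued A
  choose T hT using hf
  have hdiff : ∀ (n : ℕ) (U V : Finset ℤ), (∀ r ∉ U, f r ∈ powSubmodule A ϖ n) →
      (∀ r ∉ V, f r ∈ powSubmodule A ϖ n) →
      ∑ r ∈ U, f r - ∑ r ∈ V, f r ∈ powSubmodule A ϖ n := by
    intro n U V hU hV
    rw [← Finset.sum_sdiff_sub_sum_sdiff]
    exact sub_mem (sum_mem fun r hr => hV r (Finset.mem_sdiff.1 hr).2)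
      (sum_mem fun r hr => hU r (Finset.mem_sdiff.1 hr).2)
  have hanti : ∀ {m n : ℕ}, m ≤ n → ∀ r ∉ T n, f r ∈ powSubmodule A ϖ m := fun hmn r hr =>
    h.powSubmodule_anti hmn (hT _ r hr)
  -- Completeness concerns sequences in the ring; subtracting the sum over `T 0` makes the partial
  -- sums integral.
  obtain ⟨x, -, hx⟩ := h.complete (fun n => ∑ r ∈ T n, f r - ∑ r ∈ T 0, f r)
    (fun n => mem_powSubmodule_zero.1 (hdiff 0 _ _ (hanti (Nat.zero_le n)) (hT 0)))
    (fun n => by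
      rw [sub_sub_sub_cancel_right]
      exact hdiff n _ _ (hanti (Nat.le_succ n)) (hT n))
  have hlim : ∀ (n : ℕ) (U : Finset ℤ), (∀ r ∉ U, f r ∈ powSubmodule A ϖ n) →
      x + ∑ r ∈ T 0, f r - ∑ r ∈ U, f r ∈ powSubmodule A ϖ n := by
    intro n U hU
    have := add_mem (hx n) (hdiff n _ _ (hT n) hU)
    convert this using 1
    ring
  have hsum : HasSum f (x + ∑ r ∈ T 0, f r) := by
    intro s hs
    obtain ⟨γ, hγ, hγs⟩ := (valued_mem_nhds A _ _).1 hs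
    obtain ⟨n, hn⟩ := h.exists_valuation_lt hγ
    rw [SummationFilter.unconditional_filter, Filter.mem_map, Filter.mem_atTop_sets]
    refine ⟨T n, fun U hU => hγs (hn _ ?_)⟩
    rw [← neg_sub]
    exact neg_mem (hlim n U fun r hr => hT n r fun hr' => hr (hU hr'))
  rw [hsum.tsum_eq]
  exact hlim n S hS

theorem IsUniformizer.exists_finset_mul_mem {O : ValuationSubring F} {ϖ : F}
    (h : IsUniformizer O ϖ) {a b : ℤ → F} (ha : ∃ n : ℕ, ∀ i, ϖ ^ n * a i ∈ O)
    (ha' : ∀ n : ℕ, ∃ N : ℤ, ∀ i ≤ N, a i ∈ powSubmodule O ϖ n)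
    (hb : ∃ n : ℕ, ∀ i, ϖ ^ n * b i ∈ O)
    (hb' : ∀ n : ℕ, ∃ N : ℤ, ∀ i ≤ N, b i ∈ powSubmodule O ϖ n) (i : ℤ) (n : ℕ) :
    ∃ S : Finset ℤ, ∀ r ∉ S, a r * b (i - r) ∈ powSubmodule O ϖ n := by
  obtain ⟨m, hm⟩ := ha
  obtain ⟨m', hm'⟩ := hb
  obtain ⟨N, hN⟩ := ha' (m' + n)
  obtain ⟨N', hN'⟩ := hb' (m + n)
  -- Outside this interval one factor has low degree, and its extra precision `m'` or `m` absorbs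
  -- the denominators of the other.
  refine ⟨Finset.Icc N (i - N'), fun r hr => ?_⟩
  rw [Finset.mem_Icc, not_and_or] at hr
  rcases hr with hr | hr
  · rw [← h.mul_mem_powSubmodule_add_iff (m := m'), mul_left_comm]
    exact powSubmodule_mul_mem_left (hN r (by omega)) (hm' _)
  · rw [← h.mul_mem_powSubmodule_add_iff (m := m), ← mul_assoc]
    exact powSubmodule_mul_mem_right (hm _) (hN' _ (by omega))

end Sums

/-! ### Coordinates: the elements of `L` as series -/

section Coordinates

variable {L : Type u} [Field L]

/-- A description of the elements of `L` as series in one variable with coefficients in `k`: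
the coefficients of the elements of `L`, the variable, and the laws relating them. -/
structure Coordinates (O : ValuationSubring L) (k : Subfield L) (ϖ : L) where
  coeff : ℤ → L →+ L
  coeff_mem : ∀ i f, coeff i f ∈ k
  bounded : ∀ f, ∃ n : ℕ, ∀ i, ϖ ^ n * coeff i f ∈ O
  tendsto : ∀ f (n : ℕ), ∃ N : ℤ, ∀ i ≤ N, coeff i f ∈ powSubmodule O ϖ n
  ext : ∀ f g, (∀ i, coeff i f = coeff i g) → f = g
  exists_eq : ∀ a : ℤ → L, (∀ i, a i ∈ k) → (∃ n : ℕ, ∀ i, ϖ ^ n * a i ∈ O) →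
    (∀ n : ℕ, ∃ N : ℤ, ∀ i ≤ N, a i ∈ powSubmodule O ϖ n) → ∃ f, ∀ i, coeff i f = a i
  -- The infinite sum is replaced by congruences modulo each `ϖ ^ n`, which avoids any topology.
  coeff_mul : ∀ f g i (n : ℕ) (S : Finset ℤ),
    (∀ r ∉ S, coeff r f * coeff (i - r) g ∈ powSubmodule O ϖ n) →
    coeff i (f * g) - ∑ r ∈ S, coeff r f * coeff (i - r) g ∈ powSubmodule O ϖ n
  coeff_const : ∀ c ∈ k, ∀ i, coeff i c = if i = 0 then c else 0
  X : L
  coeff_X : ∀ i, coeff i X = if i = 1 then 1 else 0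

variable {O : ValuationSubring L} {k : Subfield L} {ϖ : L} {p : ℕ}

theorem mem_powSubmodule_integersOf {ϖ : k} {a : k} {n : ℕ} (hϖ : (ϖ : L) ≠ 0) :
    a ∈ powSubmodule (integersOf O k) ϖ n ↔ (a : L) ∈ powSubmodule O (ϖ : L) n := by
  constructor
  · rintro ⟨b, hb, rfl⟩
    exact ⟨b, hb, by simp⟩
  · rintro ⟨b, hb, hab⟩
    refine ⟨(ϖ ^ n)⁻¹ * a, ?_, ?_⟩
    · change (((ϖ ^ n)⁻¹ * a : k) : L) ∈ O
      push_cast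
      rwa [hab, inv_mul_cancel_left₀ (pow_ne_zero n hϖ)]
    · rw [mul_inv_cancel_left₀]
      exact pow_ne_zero n fun h => hϖ (by rw [h]; rfl)

theorem Setting.isUniformizer_integersOf (h : Setting O k ϖ p) :
    IsUniformizer (integersOf O k) ⟨ϖ, h.mem_k⟩ := by
  have hm : ∀ {a : k} {n : ℕ}, a ∈ powSubmodule (integersOf O k) ⟨ϖ, h.mem_k⟩ n ↔
      (a : L) ∈ powSubmodule O ϖ n := mem_powSubmodule_integersOf h.ne_zero
  refine ⟨fun h0 => h.ne_zero (congrArg Subtype.val h0), h.mem, h.inv_notMem, fun x hx => ?_,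
    fun x hx => ?_, fun f hf hf' => ?_⟩
  · obtain ⟨m, u, hu, hu', hu0, hxu⟩ := h.decomp x fun h0 => hx (Subtype.ext h0)
    have huk : u ∈ k := by
      have : u = (ϖ ^ m)⁻¹ * x := by
        rw [hxu, inv_mul_cancel_left₀ (zpow_ne_zero m h.ne_zero)]
      rw [this]
      exact mul_mem (inv_mem (zpow_mem h.mem_k _)) x.2
    exact ⟨m, ⟨u, huk⟩, hu, hu', fun h0 => hu0 (congrArg Subtype.val h0),
      Subtype.ext (hxu.trans (congrArg (· * u) (map_zpow₀ k.subtype ⟨ϖ, h.mem_k⟩ m).symm))⟩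
  · exact Subtype.ext (h.haus x fun n => hm.1 (hx n))
  · obtain ⟨x, hx, hx'⟩ := h.complete (fun n => (f n : L)) hf fun n => hm.1 (hf' n)
    have hxk := h.closed x hx fun n => ⟨f n, (f n).2, hx' n⟩
    exact ⟨⟨x, hxk⟩, hx, fun n => hm.2 (hx' n)⟩

theorem Setting.exists_pow_mul_mem_integersOf (h : Setting O k ϖ p)
    (f : DoubleCurly (integersOf O k)) :
    ∃ n : ℕ, ∀ i, (⟨ϖ, h.mem_k⟩ : k) ^ n * f.coeff i ∈ integersOf O k := by
  obtain ⟨γ, hγ⟩ := f.bounded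
  obtain ⟨a, rfl⟩ := (integersOf O k).valuation_surjective γ
  obtain ⟨n, hn⟩ := h.isUniformizer_integersOf.exists_pow_mul_mem a
  refine ⟨n, fun i => ?_⟩
  rw [← ValuationSubring.valuation_le_one_iff, map_mul] at hn ⊢
  exact (mul_le_mul' le_rfl (hγ i)).trans hn

theorem Setting.exists_mem_powSubmodule_integersOf (h : Setting O k ϖ p)
    (f : DoubleCurly (integersOf O k)) (n : ℕ) :
    ∃ N : ℤ, ∀ i ≤ N, f.coeff i ∈ powSubmodule (integersOf O k) ⟨ϖ, h.mem_k⟩ n := by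
  obtain ⟨N, hN⟩ := f.tendsto ((integersOf O k).valuation ((⟨ϖ, h.mem_k⟩ : k) ^ n))
    ((Valuation.ne_zero_iff _).2 (pow_ne_zero n h.isUniformizer_integersOf.ne_zero))
  exact ⟨N, fun i hi => mem_powSubmodule_of_valuation_le (hN i hi).le⟩

/-- The coordinates given by an isomorphism with the field of series in one variable. -/
noncomputable def Setting.coordinates (h : Setting O k ϖ p)
    (φ : DoubleCurly (integersOf O k) ≃+* L)
    (hφ : ∀ c : k, φ (DoubleCurly.monomial _ 0 c) = (c : L)) : Coordinates O k ϖ where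
  coeff i := AddMonoidHom.mk' (fun f => ((φ.symm f).coeff i : L)) fun f g => by
    rw [map_add]; rfl
  coeff_mem i f := ((φ.symm f).coeff i).2
  bounded f := h.exists_pow_mul_mem_integersOf (φ.symm f)
  tendsto f n := by
    obtain ⟨N, hN⟩ := h.exists_mem_powSubmodule_integersOf (φ.symm f) n
    exact ⟨N, fun i hi => (mem_powSubmodule_integersOf h.ne_zero).1 (hN i hi)⟩
  ext f g hfg := φ.symm.injective (DoubleCurly.ext (funext fun i => Subtype.ext (hfg i)))
  exists_eq a ha hb ht := by
    refine ⟨φ ⟨fun i => ⟨a i, ha i⟩, ?_, ?_⟩, fun i => ?_⟩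
    · obtain ⟨n, hn⟩ := hb
      refine ⟨(integersOf O k).valuation ((⟨ϖ, h.mem_k⟩ : k) ^ n)⁻¹, fun i => ?_⟩
      rw [ValuationSubring.valuation_le_iff]
      refine ⟨⟨(⟨ϖ, h.mem_k⟩ : k) ^ n * ⟨a i, ha i⟩, hn i⟩, ?_⟩
      have := pow_ne_zero n h.isUniformizer_integersOf.ne_zero
      change ((⟨ϖ, h.mem_k⟩ : k) ^ n * ⟨a i, ha i⟩) * _ = _
      field_simp
    · intro γ hγ
      obtain ⟨n, hn⟩ := h.isUniformizer_integersOf.exists_valuation_lt hγ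
      obtain ⟨N, hN⟩ := ht n
      exact ⟨N, fun i hi => hn _ ((mem_powSubmodule_integersOf h.ne_zero).2 (hN i hi))⟩
    · simp
  coeff_mul f g i n S hS := by
    have hm : ∀ {a : k} {n : ℕ}, a ∈ powSubmodule (integersOf O k) ⟨ϖ, h.mem_k⟩ n ↔
      (a : L) ∈ powSubmodule O ϖ n := mem_powSubmodule_integersOf h.ne_zero
    have hu := h.isUniformizer_integersOf
    have := hu.tsum_sub_mem (fun r => (φ.symm f).coeff r * (φ.symm g).coeff (i - r))
      (fun n => hu.exists_finset_mul_mem (h.exists_pow_mul_mem_integersOf (φ.symm f))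
        (h.exists_mem_powSubmodule_integersOf (φ.symm f))
        (h.exists_pow_mul_mem_integersOf (φ.symm g))
        (h.exists_mem_powSubmodule_integersOf (φ.symm g)) i n) (n := n) (S := S)
      fun r hr => hm.2 (hS r hr)
    rw [hm] at this
    have hmul : (φ.symm (f * g)).coeff i =
        letI := valued (integersOf O k)
        ∑' r, (φ.symm f).coeff r * (φ.symm g).coeff (i - r) := by
      rw [map_mul]; rfl
    simp only [AddMonoidHom.mk'_apply]
    rw [hmul]
    push_cast at this
    exact this
  coeff_const c hc i := by
    have : φ.symm c = DoubleCurly.monomial _ 0 ⟨c, hc⟩ := by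
      rw [RingEquiv.symm_apply_eq, hφ]
    simp only [AddMonoidHom.mk'_apply, this, DoubleCurly.monomial, Pi.single_apply]
    split_ifs <;> rfl
  X := φ (DoubleCurly.monomial _ 1 1)
  coeff_X i := by
    simp only [AddMonoidHom.mk'_apply, RingEquiv.symm_apply_apply, DoubleCurly.monomial,
      Pi.single_apply]
    split_ifs <;> rfl

end Coordinates

section

variable {F : Type u} [Field F]

/-- A version of `IsCompleteDVR.toSubring_eq` in which the discrete valuation is given by writing
each nonzero element as a power of `ϖ` times an element of a multiplicative set of units. -/
theorem IsCompleteDVR.toSubring_eq_of_zpow {B : ValuationSubring F} (hB : IsCompleteDVR B)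
    {ϖ : F} (hϖ : ϖ ≠ 0) (U : F → Prop)
    (hUmul : ∀ u w, U u → U w → U (u * w))
    (hdec : ∀ x : F, x ≠ 0 → ∃ (m : ℤ) (u : F), U u ∧ x = ϖ ^ m * u) (V : Subring F)
    (hV : ∀ u, U u → ∀ m : ℤ, ϖ ^ m * u ∈ V ↔ 0 ≤ m) : V = B.toSubring := by
  choose! g u hu hxu using hdec
  have huniq : ∀ (x : F), x ≠ 0 → ∀ (m : ℤ) (w : F), U w → x = ϖ ^ m * w → g x = m := by
    intro x hx m w hw hxw
    have h1 : ∀ n : ℤ, 0 ≤ n + g x ↔ 0 ≤ n + m := by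
      intro n
      rw [← hV _ (hu x hx), ← hV _ hw, zpow_add₀ hϖ, zpow_add₀ hϖ, mul_assoc, mul_assoc, ← hxw,
        ← hxu x hx]
    have h2 := h1 (-g x)
    have h3 := h1 (-m)
    omega
  refine hB.toSubring_eq g (fun x y hx hy => ?_) V (fun x hx => ?_) fun htop => ?_
  · refine huniq _ (mul_ne_zero hx hy) _ _ (hUmul _ _ (hu x hx) (hu y hy)) ?_
    conv_lhs => rw [hxu x hx, hxu y hy]
    rw [zpow_add₀ hϖ]
    ring
  · conv_lhs => rw [hxu x hx]
    exact hV _ (hu x hx) _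
  · have := (hV _ (hu 1 one_ne_zero) (-1)).1 (htop ▸ trivial)
    omega

end

/-! ### The valuation of `L` read off the coefficients -/

namespace Coordinates

variable {L : Type u} [Field L] {O : ValuationSubring L} {k : Subfield L} {ϖ : L} {p : ℕ}
  (C : Coordinates O k ϖ)

theorem coeff_one (i : ℤ) : C.coeff i 1 = if i = 0 then 1 else 0 :=
  C.coeff_const 1 k.one_mem i

theorem X_ne_zero : C.X ≠ 0 := by
  intro h
  have := C.coeff_X 1
  rw [h, map_zero] at this
  simp at this

/-- The coefficients of `f` are integral, and modulo `ϖ` the series `f` starts in degree `i`. -/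
def HasOrder (f : L) (i : ℤ) : Prop :=
  (∀ j, C.coeff j f ∈ O) ∧ C.coeff i f ∉ powSubmodule O ϖ 1 ∧
    ∀ j < i, C.coeff j f ∈ powSubmodule O ϖ 1

theorem HasOrder.unique {f g : L} {i j : ℤ} (hf : C.HasOrder f i) (hg : C.HasOrder g j)
    (hfg : ∀ l, C.coeff l (f - g) ∈ powSubmodule O ϖ 1) : i = j := by
  by_contra hne
  rcases lt_or_gt_of_ne hne with hij | hij
  · apply hf.2.1
    have := add_mem (hfg i) (hg.2.2 i hij)
    rwa [← map_add, sub_add_cancel] at this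
  · apply hg.2.1
    have := sub_mem (hf.2.2 j hij) (hfg j)
    rwa [← map_sub, sub_sub_cancel] at this

theorem exists_hasOrder {f : L} (hf : ∀ i, C.coeff i f ∈ O)
    (hf1 : ∃ i, C.coeff i f ∉ powSubmodule O ϖ 1) : ∃ i, C.HasOrder f i := by
  obtain ⟨N, hN⟩ := C.tendsto f 1
  obtain ⟨i, hi, hmin⟩ := Int.exists_least_of_bdd
    (P := fun i => C.coeff i f ∉ powSubmodule O ϖ 1)
    ⟨N, fun z hz => by by_contra! hlt; exact hz (hN z hlt.le)⟩ hf1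
  exact ⟨i, hf, hi, fun j hj => by
    by_contra hj'
    exact absurd (hmin j hj') (not_le.2 hj)⟩

theorem HasOrder.ne_zero {f : L} {i : ℤ} (hf : C.HasOrder f i) : f ≠ 0 := by
  rintro rfl
  exact hf.2.1 (by rw [map_zero]; exact zero_mem _)

theorem coeff_mul_mem {f g : L} {i : ℤ} {n : ℕ}
    (hn : ∀ r, C.coeff r f * C.coeff (i - r) g ∈ powSubmodule O ϖ n) :
    C.coeff i (f * g) ∈ powSubmodule O ϖ n := by
  simpa using C.coeff_mul f g i n ∅ fun r _ => hn r

theorem forall_coeff_mul_mem {f g : L} (hf : ∀ i, C.coeff i f ∈ O) (hg : ∀ i, C.coeff i g ∈ O)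
    (i : ℤ) : C.coeff i (f * g) ∈ O :=
  mem_powSubmodule_zero.1 (C.coeff_mul_mem fun r => mem_powSubmodule_zero.2
    (mul_mem (hf r) (hg _)))

section

variable (h : IsUniformizer O ϖ)
include h

theorem coeff_mul_eq {f g : L} {i : ℤ} {S : Finset ℤ}
    (hS : ∀ r ∉ S, C.coeff r f * C.coeff (i - r) g = 0) :
    C.coeff i (f * g) = ∑ r ∈ S, C.coeff r f * C.coeff (i - r) g := by
  rw [← sub_eq_zero]
  exact h.haus _ fun n => C.coeff_mul f g i n S fun r hr => by rw [hS r hr]; exact zero_mem _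

theorem coeff_const_mul {c : L} (hc : c ∈ k) (f : L) (i : ℤ) :
    C.coeff i (c * f) = c * C.coeff i f := by
  rw [C.coeff_mul_eq h (S := {0})]
  · simp [C.coeff_const c hc]
  · intro r hr
    rw [C.coeff_const c hc, if_neg (by simpa using hr), zero_mul]

theorem coeff_X_mul (f : L) (i : ℤ) : C.coeff i (C.X * f) = C.coeff (i - 1) f := by
  rw [C.coeff_mul_eq h (S := {1})]
  · simp [C.coeff_X]
  · intro r hr
    rw [C.coeff_X, if_neg (by simpa using hr), zero_mul]

theorem coeff_X_pow_mul (n : ℕ) (f : L) (i : ℤ) :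
    C.coeff i (C.X ^ n * f) = C.coeff (i - n) f := by
  induction n generalizing i with
  | zero => simp
  | succ n ih =>
    rw [pow_succ', mul_assoc, C.coeff_X_mul h, ih]
    congr 2
    push_cast; ring

theorem coeff_X_zpow_mul (m : ℤ) (f : L) (i : ℤ) :
    C.coeff i (C.X ^ m * f) = C.coeff (i - m) f := by
  obtain ⟨n, rfl | rfl⟩ := m.eq_nat_or_neg
  · rw [zpow_natCast, C.coeff_X_pow_mul h]
  · have := C.coeff_X_pow_mul h n (C.X ^ (-(n : ℤ)) * f) (i + n)
    rw [← zpow_natCast, ← mul_assoc, ← zpow_add₀ C.X_ne_zero, add_neg_cancel, zpow_zero, one_mul,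
      add_sub_cancel_right] at this
    rw [sub_neg_eq_add, this]

theorem coeff_X_zpow (m : ℤ) (i : ℤ) : C.coeff i (C.X ^ m) = if i = m then 1 else 0 := by
  have := C.coeff_X_zpow_mul h m 1 i
  rw [mul_one, C.coeff_one] at this
  rw [this]
  simp [sub_eq_zero]

/-- Gauss's lemma: modulo `ϖ` only the product of the two leading coefficients reaches degree `i +
j`. -/
theorem HasOrder.mul {f g : L} {i j : ℤ} (hf : C.HasOrder f i) (hg : C.HasOrder g j) :
    C.HasOrder (f * g) (i + j) := by
  refine ⟨C.forall_coeff_mul_mem hf.1 hg.1, fun hm => ?_, fun l hl => ?_⟩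
  · have := C.coeff_mul f g (i + j) 1 {i} (fun r hr => by
      rcases lt_or_gt_of_ne (show r ≠ i by simpa using hr) with hr | hr
      · exact powSubmodule_mul_mem_left (hf.2.2 r hr) (hg.1 _)
      · exact powSubmodule_mul_mem_right (hf.1 _) (hg.2.2 _ (by omega)))
    have := sub_mem hm this
    rw [sub_sub_cancel, Finset.sum_singleton, add_sub_cancel_left, h.mul_mem_iff (hf.1 _) (hg.1 _)]
      at this
    exact this.elim hf.2.1 hg.2.1
  · refine C.coeff_mul_mem fun r => ?_
    rcases lt_or_ge r i with hr | hr
    · exact powSubmodule_mul_mem_left (hf.2.2 r hr) (hg.1 _)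
    · exact powSubmodule_mul_mem_right (hf.1 _) (hg.2.2 _ (by omega))

theorem hasOrder_X_zpow_mul {f : L} {i : ℤ} (hf : C.HasOrder f i) (m : ℤ) :
    C.HasOrder (C.X ^ m * f) (m + i) := by
  refine ⟨fun j => ?_, ?_, fun j hj => ?_⟩
  · rw [C.coeff_X_zpow_mul h]; exact hf.1 _
  · rw [C.coeff_X_zpow_mul h, add_sub_cancel_left]; exact hf.2.1
  · rw [C.coeff_X_zpow_mul h]; exact hf.2.2 _ (by omega)

theorem hasOrder_one : C.HasOrder 1 0 := by
  refine ⟨fun j => ?_, ?_, fun j hj => ?_⟩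
  · rw [C.coeff_one]; split_ifs
    exacts [one_mem _, zero_mem _]
  · rw [C.coeff_one, if_pos rfl]; exact h.one_notMem
  · rw [C.coeff_one, if_neg hj.ne]; exact zero_mem _

end

theorem exists_zpow_mul_hasOrder (hS : Setting O k ϖ p) {f : L} (hf : f ≠ 0) :
    ∃ (m : ℤ) (g : L), (∃ i, C.HasOrder g i) ∧ f = ϖ ^ m * g := by
  classical
  have h := hS.toIsUniformizer
  obtain ⟨N, hN⟩ := C.bounded f
  have hfN : ∀ i, C.coeff i (ϖ ^ N * f) ∈ O := fun i => by
    rw [C.coeff_const_mul h (pow_mem hS.mem_k N)]; exact hN i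
  have hex : ∃ n, ∃ i, C.coeff i (ϖ ^ N * f) ∉ powSubmodule O ϖ n := by
    by_contra! hall
    have : ϖ ^ N * f = 0 := C.ext _ _ fun i => by
      rw [map_zero]; exact h.haus _ fun n => hall n i
    exact mul_ne_zero (pow_ne_zero N h.ne_zero) hf this
  obtain ⟨n, hn⟩ : ∃ n, Nat.find hex = n + 1 := by
    refine Nat.exists_eq_succ_of_ne_zero fun h0 => ?_
    obtain ⟨i, hi⟩ := Nat.find_spec hex
    rw [h0, mem_powSubmodule_zero] at hi
    exact hi (hfN i)
  have hn' : ∀ i, C.coeff i (ϖ ^ N * f) ∈ powSubmodule O ϖ n := by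
    have := Nat.find_min hex (m := n) (by omega)
    push Not at this
    exact this
  have hkey : ∀ i, C.coeff i (ϖ ^ N * f) = ϖ ^ n * C.coeff i ((ϖ ^ n)⁻¹ * (ϖ ^ N * f)) := by
    intro i
    rw [C.coeff_const_mul h (inv_mem (pow_mem hS.mem_k n)), mul_inv_cancel_left₀]
    exact pow_ne_zero n h.ne_zero
  refine ⟨n - N, (ϖ ^ n)⁻¹ * (ϖ ^ N * f), C.exists_hasOrder (fun i => ?_) ?_, ?_⟩
  · rw [← mem_powSubmodule_zero, ← h.mul_mem_powSubmodule_add_iff (m := n), ← hkey]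
    exact hn' i
  · obtain ⟨i, hi⟩ := Nat.find_spec hex
    refine ⟨i, ?_⟩
    rwa [hn, hkey, h.mul_mem_powSubmodule_add_iff] at hi
  · have := h.ne_zero
    rw [zpow_sub₀ this, zpow_natCast, zpow_natCast]
    field_simp

/-- The Gauss valuation on the coefficients is discrete, with units the elements having an order, so
its ring must be the complete ring `O`. No continuity of the isomorphism is needed. -/
theorem mem_iff (hS : Setting O k ϖ p) (f : L) : f ∈ O ↔ ∀ i, C.coeff i f ∈ O := by
  have h := hS.toIsUniformizer
  let V : Subring L :=
    { carrier := {f | ∀ i, C.coeff i f ∈ O}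
      mul_mem' := fun hf hg => C.forall_coeff_mul_mem hf hg
      one_mem' := (C.hasOrder_one h).1
      add_mem' := fun hf hg i => by rw [map_add]; exact add_mem (hf i) (hg i)
      zero_mem' := fun i => by rw [map_zero]; exact zero_mem _
      neg_mem' := fun hf i => by rw [map_neg]; exact neg_mem (hf i) }
  have key := hS.complete_dvr.toSubring_eq_of_zpow h.ne_zero (fun f => ∃ i, C.HasOrder f i)
    (fun f g ⟨i, hf⟩ ⟨j, hg⟩ => ⟨_, hf.mul C h hg⟩)
    (fun f hf => C.exists_zpow_mul_hasOrder hS hf) V (fun f ⟨i, hf⟩ m => by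
      have hm : ∀ j, C.coeff j (ϖ ^ m * f) = ϖ ^ m * C.coeff j f :=
        C.coeff_const_mul h (zpow_mem hS.mem_k m) f
      constructor
      · intro hV
        have h1 := hV i
        rw [hm] at h1
        rw [← h.zpow_mem_iff]
        have := mul_mem h1 (h.inv_mem (hf.1 i) hf.2.1)
        rwa [mul_inv_cancel_right₀] at this
        intro h0
        exact hf.2.1 (by rw [h0]; exact zero_mem _)
      · intro hm0 j
        rw [hm]
        exact mul_mem (h.zpow_mem_iff.2 hm0) (hf.1 j))
  rw [← ValuationSubring.mem_toSubring, ← key]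
  rfl

theorem mem_powSubmodule_iff (hS : Setting O k ϖ p) (f : L) (n : ℕ) :
    f ∈ powSubmodule O ϖ n ↔ ∀ i, C.coeff i f ∈ powSubmodule O ϖ n := by
  have h := hS.toIsUniformizer
  have hkey : ∀ i, C.coeff i f = ϖ ^ n * C.coeff i ((ϖ ^ n)⁻¹ * f) := by
    intro i
    rw [C.coeff_const_mul h (inv_mem (pow_mem hS.mem_k n)), mul_inv_cancel_left₀]
    exact pow_ne_zero n h.ne_zero
  have hf : f = ϖ ^ n * ((ϖ ^ n)⁻¹ * f) := by
    rw [mul_inv_cancel_left₀]; exact pow_ne_zero n h.ne_zero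
  have e1 : f ∈ powSubmodule O ϖ n ↔ (ϖ ^ n)⁻¹ * f ∈ O := by
    conv_lhs => rw [hf]
    exact (h.mul_mem_powSubmodule_add_iff (m := n) (n := 0)).trans mem_powSubmodule_zero
  rw [e1, C.mem_iff hS]
  refine forall_congr' fun i => ?_
  rw [hkey]
  exact (mem_powSubmodule_zero.symm.trans (h.mul_mem_powSubmodule_add_iff (m := n) (n := 0)).symm)

end Coordinates

/-! ### The residue field and first local parameters -/

namespace Coordinates

variable {L : Type u} [Field L] {O : ValuationSubring L} {k : Subfield L} {ϖ : L} {p : ℕ}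
  (C : Coordinates O k ϖ) (h : Setting O k ϖ p)
include h

theorem zpow_X_mem (m : ℤ) : C.X ^ m ∈ O := by
  rw [C.mem_iff h]
  intro i
  rw [C.coeff_X_zpow h.toIsUniformizer]
  split_ifs
  exacts [one_mem _, zero_mem _]

theorem X_mem : C.X ∈ O := by simpa using C.zpow_X_mem h 1

theorem residue_X_zpow (m : ℤ) : IsLocalRing.residue O ⟨C.X ^ m, C.zpow_X_mem h m⟩ =
    IsLocalRing.residue O ⟨C.X, C.X_mem h⟩ ^ m := by
  have hn : ∀ n : ℕ, IsLocalRing.residue O ⟨C.X ^ (n : ℤ), C.zpow_X_mem h n⟩ =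
    IsLocalRing.residue O ⟨C.X, C.X_mem h⟩ ^ n := fun n => by
    rw [← map_pow]
    congr 1
    exact Subtype.ext (by simp)
  obtain ⟨n, rfl | rfl⟩ := m.eq_nat_or_neg
  · rw [hn, zpow_natCast]
  · rw [zpow_neg (IsLocalRing.residue O ⟨C.X, C.X_mem h⟩), zpow_natCast, ← hn]
    refine eq_inv_of_mul_eq_one_left ?_
    rw [← map_mul, ← map_one (IsLocalRing.residue O)]
    congr 1
    refine Subtype.ext ?_
    change C.X ^ (-(n : ℤ)) * C.X ^ (n : ℤ) = 1
    rw [← zpow_add₀ C.X_ne_zero]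
    simp

theorem coeff_sub_mem_of_residue_eq {f g : O}
    (hfg : IsLocalRing.residue O f = IsLocalRing.residue O g) (i : ℤ) :
    C.coeff i f - C.coeff i g ∈ powSubmodule O ϖ 1 := by
  rw [← sub_eq_zero, ← map_sub, ← h.mem_powSubmodule_one_iff] at hfg
  rw [← map_sub]
  exact (C.mem_powSubmodule_iff h _ 1).1 hfg i

theorem exists_hasOrder_of_notMem {f : L} (hf : f ∈ O) (hf1 : f ∉ powSubmodule O ϖ 1) :
    ∃ i, C.HasOrder f i := by
  refine C.exists_hasOrder ((C.mem_iff h f).1 hf) ?_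
  by_contra! hall
  exact hf1 ((C.mem_powSubmodule_iff h f 1).2 hall)

/-- Uniqueness again, now in the residue field: the order in `X` is a discrete valuation there, with
units the residues of elements of order `0`. As `A` does not depend on the coordinates, two
variables become comparable. -/
theorem residue_mem_iff {A : ValuationSubring (IsLocalRing.ResidueField O)}
    (hA : IsCompleteDVR A) (f : O) :
    IsLocalRing.residue O f ∈ A ↔ ∀ i < 0, C.coeff i f ∈ powSubmodule O ϖ 1 := by
  have hu := h.toIsUniformizer
  let V : Subring (IsLocalRing.ResidueField O) :=
    { carrier := {y | ∃ f : O, IsLocalRing.residue O f = y ∧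
        ∀ i < 0, C.coeff i f ∈ powSubmodule O ϖ 1}
      mul_mem' := by
        rintro _ _ ⟨f, rfl, hf⟩ ⟨g, rfl, hg⟩
        refine ⟨f * g, map_mul _ _ _, fun i hi => C.coeff_mul_mem fun r => ?_⟩
        rcases lt_or_ge r 0 with hr | hr
        · exact powSubmodule_mul_mem_left (hf r hr) ((C.mem_iff h g).1 g.2 _)
        · exact powSubmodule_mul_mem_right ((C.mem_iff h f).1 f.2 _) (hg _ (by omega))
      one_mem' := ⟨1, map_one _, fun i hi => (C.hasOrder_one hu).2.2 i hi⟩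
      add_mem' := by
        rintro _ _ ⟨f, rfl, hf⟩ ⟨g, rfl, hg⟩
        refine ⟨f + g, map_add _ _ _, fun i hi => ?_⟩
        have := add_mem (hf i hi) (hg i hi)
        rwa [← map_add] at this
      zero_mem' := ⟨0, map_zero _, fun i hi => by
        have : C.coeff i ((0 : O) : L) = 0 := map_zero _
        rw [this]; exact zero_mem _⟩
      neg_mem' := by
        rintro _ ⟨f, rfl, hf⟩
        refine ⟨-f, map_neg _ _, fun i hi => ?_⟩
        have := neg_mem (hf i hi)
        rwa [← map_neg] at this }
  have hmem : ∀ f : O, IsLocalRing.residue O f ∈ V ↔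
      ∀ i < 0, C.coeff i f ∈ powSubmodule O ϖ 1 := by
    intro f
    refine ⟨?_, fun hf => ⟨f, rfl, hf⟩⟩
    rintro ⟨g, hgf, hg⟩ i hi
    have := sub_mem (hg i hi) (C.coeff_sub_mem_of_residue_eq h hgf i)
    rwa [sub_sub_cancel] at this
  have hX0 : IsLocalRing.residue O ⟨C.X, C.X_mem h⟩ ≠ 0 := by
    rw [Ne, ← h.mem_powSubmodule_one_iff]
    refine h.notMem_powSubmodule_of_inv_mem C.X_ne_zero ?_
    simpa using C.zpow_X_mem h (-1)
  have key := hA.toSubring_eq_of_zpow hX0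
    (fun y => ∃ f : O, IsLocalRing.residue O f = y ∧ C.HasOrder f 0)
    (by
      rintro _ _ ⟨f, rfl, hf⟩ ⟨g, rfl, hg⟩
      exact ⟨f * g, map_mul _ _ _, hf.mul C hu hg⟩)
    (by
      intro y hy
      obtain ⟨f, rfl⟩ := IsLocalRing.residue_surjective y
      rw [Ne, ← h.mem_powSubmodule_one_iff] at hy
      obtain ⟨i, hi⟩ := C.exists_hasOrder_of_notMem h f.2 hy
      refine ⟨i, _, ⟨⟨C.X ^ (-i) , C.zpow_X_mem h _⟩ * f, rfl, ?_⟩, ?_⟩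
      · have := C.hasOrder_X_zpow_mul hu hi (-i)
        rwa [neg_add_cancel] at this
      · rw [map_mul, C.residue_X_zpow h, ← mul_assoc, ← zpow_add₀ hX0]
        simp) V
    (by
      rintro _ ⟨f, rfl, hf⟩ m
      rw [← C.residue_X_zpow h, ← map_mul, hmem]
      have hm := C.hasOrder_X_zpow_mul hu hf m
      rw [add_zero] at hm
      constructor
      · intro hall
        by_contra! hneg
        exact hm.2.1 (hall m hneg)
      · intro hm0 i hi
        exact hm.2.2 i (by omega))
  rw [← ValuationSubring.mem_toSubring, ← key, hmem]

theorem inv_hasOrder_zero {f : L} (hf : C.HasOrder f 0) : C.HasOrder f⁻¹ 0 := by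
  have hfO := (C.mem_iff h f).2 hf.1
  have hf1 : f ∉ powSubmodule O ϖ 1 := fun hm => hf.2.1 ((C.mem_powSubmodule_iff h f 1).1 hm 0)
  have hinv := h.inv_mem hfO hf1
  have hf0 := hf.ne_zero C
  obtain ⟨i, hi⟩ := C.exists_hasOrder_of_notMem h hinv
    (h.notMem_powSubmodule_of_inv_mem (inv_ne_zero hf0) (by rwa [inv_inv]))
  have h1 := hf.mul C h.toIsUniformizer hi
  rw [mul_inv_cancel₀ hf0] at h1
  have := h1.unique C (C.hasOrder_one h.toIsUniformizer) (by simp)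
  rw [zero_add] at this
  rwa [this] at hi

theorem hasOrder_zero_of_residue_unit {A : ValuationSubring (IsLocalRing.ResidueField O)}
    (hA : IsCompleteDVR A) {f : O} (hf0 : IsLocalRing.residue O f ≠ 0)
    (hf : IsLocalRing.residue O f ∈ A) (hf' : (IsLocalRing.residue O f)⁻¹ ∈ A) :
    C.HasOrder f 0 := by
  have hf1 := hf0
  rw [Ne, ← h.mem_powSubmodule_one_iff] at hf1
  obtain ⟨i, hi⟩ := C.exists_hasOrder_of_notMem h f.2 hf1
  have hinv := h.inv_mem f.2 hf1
  have hL0 : (f : L) ≠ 0 := hi.ne_zero C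
  have hres : (IsLocalRing.residue O f)⁻¹ = IsLocalRing.residue O ⟨(f : L)⁻¹, hinv⟩ := by
    symm
    refine eq_inv_of_mul_eq_one_left ?_
    rw [← map_mul, ← map_one (IsLocalRing.residue O)]
    congr 1
    exact Subtype.ext (inv_mul_cancel₀ hL0)
  obtain ⟨j, hj⟩ := C.exists_hasOrder_of_notMem h hinv
    (h.notMem_powSubmodule_of_inv_mem (inv_ne_zero hL0) (by rw [inv_inv]; exact f.2))
  rw [C.residue_mem_iff h hA] at hf
  rw [hres, C.residue_mem_iff h hA] at hf'
  have h1 := hi.mul C h.toIsUniformizer hj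
  rw [mul_inv_cancel₀ hL0] at h1
  have h2 := h1.unique C (C.hasOrder_one h.toIsUniformizer) (by simp)
  have hi0 : 0 ≤ i := by by_contra! hn; exact hi.2.1 (hf i hn)
  have hj0 : 0 ≤ j := by by_contra! hn; exact hj.2.1 (hf' j hn)
  have : i = 0 := by omega
  rwa [this] at hi

theorem hasOrder_X : C.HasOrder C.X 1 := by
  have := C.hasOrder_X_zpow_mul h.toIsUniformizer (C.hasOrder_one h.toIsUniformizer) 1
  simpa using this

theorem residue_X_mem {A : ValuationSubring (IsLocalRing.ResidueField O)}
    (hA : IsCompleteDVR A) : IsLocalRing.residue O ⟨C.X, C.X_mem h⟩ ∈ A :=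
  (C.residue_mem_iff h hA _).2 fun i hi => (C.hasOrder_X h).2.2 i (by omega)

theorem irreducible_residue_X {A : ValuationSubring (IsLocalRing.ResidueField O)}
    (hA : IsCompleteDVR A) :
    Irreducible (⟨IsLocalRing.residue O ⟨C.X, C.X_mem h⟩, C.residue_X_mem h hA⟩ : A) := by
  have hu := h.toIsUniformizer
  have hord : ∀ f : O, IsLocalRing.residue O f ∈ A → IsLocalRing.residue O f ≠ 0 →
      ∃ i, 0 ≤ i ∧ C.HasOrder f i := by
    intro f hf hf0
    rw [Ne, ← h.mem_powSubmodule_one_iff] at hf0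
    obtain ⟨i, hi⟩ := C.exists_hasOrder_of_notMem h f.2 hf0
    rw [C.residue_mem_iff h hA] at hf
    exact ⟨i, by by_contra! hn; exact hi.2.1 (hf i hn), hi⟩
  have hmul : ∀ (f g : O) (i j n : ℤ) (l : O), C.HasOrder f i → C.HasOrder g j → C.HasOrder l n →
      IsLocalRing.residue O l = IsLocalRing.residue O f * IsLocalRing.residue O g →
      n = i + j := by
    intro f g i j n l hf hg hl hlfg
    rw [← map_mul] at hlfg
    exact hl.unique C (hf.mul C hu hg) fun i => by
      rw [map_sub]
      exact C.coeff_sub_mem_of_residue_eq h hlfg i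
  have hunit : ∀ f : O, (hf : IsLocalRing.residue O f ∈ A) → C.HasOrder f 0 →
      IsUnit (⟨IsLocalRing.residue O f, hf⟩ : A) := by
    intro f hf hf0
    have hinv := C.inv_hasOrder_zero h hf0
    have hinvO := (C.mem_iff h _).2 hinv.1
    refine IsUnit.of_mul_eq_one ⟨IsLocalRing.residue O ⟨_, hinvO⟩,
      (C.residue_mem_iff h hA _).2 hinv.2.2⟩ (Subtype.ext ?_)
    change IsLocalRing.residue O f * IsLocalRing.residue O ⟨_, hinvO⟩ = 1
    rw [← map_mul, ← map_one (IsLocalRing.residue O)]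
    congr 1
    exact Subtype.ext (mul_inv_cancel₀ (hf0.ne_zero C))
  have hX0 : IsLocalRing.residue O ⟨C.X, C.X_mem h⟩ ≠ 0 := by
    rw [Ne, ← h.mem_powSubmodule_one_iff]
    exact fun hm => (C.hasOrder_X h).2.1 ((C.mem_powSubmodule_iff h _ 1).1 hm 1)
  refine ⟨fun hX => ?_, ?_⟩
  · obtain ⟨⟨b, hb⟩, hab⟩ := hX.exists_right_inv
    have hab' : IsLocalRing.residue O ⟨C.X, C.X_mem h⟩ * b = 1 := congrArg Subtype.val hab
    obtain ⟨g, rfl⟩ := IsLocalRing.residue_surjective b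
    obtain ⟨j, hj, hgj⟩ := hord g hb (fun h0 => by simp [h0] at hab')
    have := hmul ⟨C.X, C.X_mem h⟩ _ _ _ 0 1 (C.hasOrder_X h) hgj (C.hasOrder_one hu)
      (by rw [map_one]; exact hab'.symm)
    omega
  · rintro ⟨a, ha⟩ ⟨b, hb⟩ hab
    have hab' : IsLocalRing.residue O ⟨C.X, C.X_mem h⟩ = a * b := congrArg Subtype.val hab
    obtain ⟨f, rfl⟩ := IsLocalRing.residue_surjective a
    obtain ⟨g, rfl⟩ := IsLocalRing.residue_surjective b
    obtain ⟨i, hi, hfi⟩ := hord f ha (fun h0 => hX0 (by rw [hab', h0, zero_mul]))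
    obtain ⟨j, hj, hgj⟩ := hord g hb (fun h0 => hX0 (by rw [hab', h0, mul_zero]))
    have := hmul _ _ _ _ 1 _ hfi hgj (C.hasOrder_X h) hab'
    have : i = 0 ∨ j = 0 := by omega
    rcases this with rfl | rfl
    · exact Or.inl (hunit f ha hfi)
    · exact Or.inr (hunit g hb hgj)

theorem isFirstLocalParameter_X {A : ValuationSubring (IsLocalRing.ResidueField O)}
    (hA : IsLocalFieldIntegers A) : IsFirstLocalParameter O ⟨C.X, C.X_mem h⟩ :=
  ⟨A, hA, _, C.irreducible_residue_X h hA.toIsCompleteDVR, rfl⟩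

/-- The residues of both variables are uniformizers of the same ring `A`, so their quotient is a
unit of `A`. -/
theorem hasOrder_X_div_X {A : ValuationSubring (IsLocalRing.ResidueField O)}
    (hA : IsCompleteDVR A) (C' : Coordinates O k ϖ) : C.HasOrder (C'.X / C.X) 0 := by
  have := hA.dvr
  have hinv : C.X⁻¹ ∈ O := by simpa using C.zpow_X_mem h (-1)
  have hX0 : IsLocalRing.residue O ⟨C.X, C.X_mem h⟩ ≠ 0 := fun h0 =>
    (C.irreducible_residue_X h hA).ne_zero (Subtype.ext h0)
  have hq : C'.X / C.X ∈ O := by rw [div_eq_mul_inv]; exact mul_mem (C'.X_mem h) hinv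
  obtain ⟨u, hu⟩ := IsDiscreteValuationRing.associated_of_irreducible A
    (C.irreducible_residue_X h hA) (C'.irreducible_residue_X h hA)
  have hu' : IsLocalRing.residue O ⟨C.X, C.X_mem h⟩ * ((u : A) : IsLocalRing.ResidueField O) =
    IsLocalRing.residue O ⟨C'.X, C'.X_mem h⟩ := congrArg Subtype.val hu
  have hres : IsLocalRing.residue O ⟨C'.X / C.X, hq⟩ = ((u : A) : IsLocalRing.ResidueField O) := by
    refine mul_left_cancel₀ hX0 ?_
    rw [hu', ← map_mul]
    congr 1
    exact Subtype.ext (mul_div_cancel₀ _ C.X_ne_zero)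
  have huinv : (((u⁻¹ : Aˣ) : A) : IsLocalRing.ResidueField O) =
      ((u : A) : IsLocalRing.ResidueField O)⁻¹ := by
    refine eq_inv_of_mul_eq_one_left ?_
    have : ((u⁻¹ : Aˣ) : A) * (u : A) = 1 := by simp
    exact congrArg Subtype.val this
  refine C.hasOrder_zero_of_residue_unit h hA (f := ⟨C'.X / C.X, hq⟩) ?_ ?_ ?_
  · rw [hres]; exact fun h0 => u.ne_zero (Subtype.ext h0)
  · rw [hres]; exact (u : A).2
  · rw [hres, ← huinv]; exact ((u⁻¹ : Aˣ) : A).2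

end Coordinates

/-! ### The derivative with respect to the variable -/

namespace Coordinates

variable {L : Type u} [Field L] {O : ValuationSubring L} {k : Subfield L} {ϖ : L} {p : ℕ}
  (C : Coordinates O k ϖ)

theorem exists_derivative (f : L) :
    ∃ g : L, ∀ i : ℤ, C.coeff i g = ((i + 1 : ℤ) : L) * C.coeff (i + 1) f := by
  refine C.exists_eq _ (fun i => mul_mem (intCast_mem _ _) (C.coeff_mem _ _)) ?_ fun n => ?_
  · obtain ⟨n, hn⟩ := C.bounded f
    refine ⟨n, fun i => ?_⟩
    rw [mul_left_comm]
    exact mul_mem (intCast_mem _ _) (hn _)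
  · obtain ⟨N, hN⟩ := C.tendsto f n
    exact ⟨N - 1, fun i hi => powSubmodule_mul_mem_right (intCast_mem _ _) (hN _ (by omega))⟩

/-- The derivative of a series with respect to the variable. -/
noncomputable def derivative (f : L) : L := (C.exists_derivative f).choose

theorem coeff_derivative (f : L) (i : ℤ) :
    C.coeff i (C.derivative f) = ((i + 1 : ℤ) : L) * C.coeff (i + 1) f :=
  (C.exists_derivative f).choose_spec i

theorem coeff_derivative_neg_one (f : L) : C.coeff (-1) (C.derivative f) = 0 := by
  simp [C.coeff_derivative]

theorem derivative_add (f g : L) : C.derivative (f + g) = C.derivative f + C.derivative g :=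
  C.ext _ _ fun i => by simp only [map_add, C.coeff_derivative]; ring

/-- The elements of `O` with coefficients in degrees `< N` divisible by `ϖ ^ n`. -/
def orderIdeal (N : ℤ) (n : ℕ) : AddSubgroup L where
  carrier := {f | f ∈ O ∧ ∀ i < N, C.coeff i f ∈ powSubmodule O ϖ n}
  add_mem' := fun hf hg => ⟨add_mem hf.1 hg.1, fun i hi => by
    rw [map_add]; exact add_mem (hf.2 i hi) (hg.2 i hi)⟩
  zero_mem' := ⟨zero_mem _, fun i _ => by rw [map_zero]; exact zero_mem _⟩
  neg_mem' := fun hf => ⟨neg_mem hf.1, fun i hi => by rw [map_neg]; exact neg_mem (hf.2 i hi)⟩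

variable (h : Setting O k ϖ p)
include h

theorem exists_finset_coeff (f g : L) (i : ℤ) (n : ℕ) :
    ∃ S : Finset ℤ, ∀ r ∉ S, C.coeff r f * C.coeff (i - r) g ∈ powSubmodule O ϖ n :=
  h.exists_finset_mul_mem (C.bounded f) (C.tendsto f) (C.bounded g) (C.tendsto g) i n

theorem derivative_mul (f g : L) :
    C.derivative (f * g) = f * C.derivative g + C.derivative f * g := by
  refine C.ext _ _ fun i => ?_
  rw [← sub_eq_zero]
  refine h.haus _ fun n => ?_
  obtain ⟨S, hS⟩ := C.exists_finset_coeff h f g (i + 1) n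
  have h1 := C.coeff_mul f g (i + 1) n S hS
  have h2 := C.coeff_mul f (C.derivative g) i n S (fun r hr => by
    rw [C.coeff_derivative, mul_left_comm, sub_add_eq_add_sub]
    exact powSubmodule_mul_mem_right (intCast_mem _ _) (hS r hr))
  have h3 := C.coeff_mul (C.derivative f) g i n (S.map (Equiv.subRight (1 : ℤ)).toEmbedding)
    (fun r hr => by
      rw [C.coeff_derivative, mul_assoc]
      refine powSubmodule_mul_mem_right (intCast_mem _ _) ?_
      have := hS (r + 1) (fun hm => hr (Finset.mem_map.2 ⟨r + 1, hm, by simp⟩))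
      rwa [add_sub_add_right_eq_sub] at this)
  rw [Finset.sum_map] at h3
  have h4 := powSubmodule_mul_mem_right (intCast_mem O (i + 1)) h1
  rw [C.coeff_derivative, map_add]
  have := sub_mem h4 (add_mem h2 h3)
  convert this using 1
  -- Split `i + 1 = (i + 1 - r) + r`. The last sum is shifted because the factor `r` belongs to the
  -- coefficient of degree `r - 1` of the derivative of `f`.
  have hsum : ((i + 1 : ℤ) : L) * ∑ r ∈ S, C.coeff r f * C.coeff (i + 1 - r) g =
      ∑ r ∈ S, C.coeff r f * C.coeff (i - r) (C.derivative g) +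
      ∑ r ∈ S, C.coeff ((Equiv.subRight (1 : ℤ)).toEmbedding r) (C.derivative f) *
        C.coeff (i - (Equiv.subRight (1 : ℤ)).toEmbedding r) g := by
    rw [Finset.mul_sum, ← Finset.sum_add_distrib]
    refine Finset.sum_congr rfl fun r _ => ?_
    have e1 : i - r + 1 = i + 1 - r := by ring
    have e2 : (Equiv.subRight (1 : ℤ)).toEmbedding r = r - 1 := rfl
    have e3 : i - (r - 1) = i + 1 - r := by ring
    rw [C.coeff_derivative, C.coeff_derivative, e2, sub_add_cancel, e1, e3]
    push_cast
    ring
  linear_combination hsum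

theorem derivative_mem {f : L} (hf : f ∈ O) : C.derivative f ∈ O := by
  rw [C.mem_iff h] at hf ⊢
  intro i
  rw [C.coeff_derivative]
  exact mul_mem (intCast_mem _ _) (hf _)

omit h in
theorem derivative_const {c : L} (hc : c ∈ k) : C.derivative c = 0 :=
  C.ext _ _ fun i => by
    rw [C.coeff_derivative, C.coeff_const c hc, map_zero]
    split_ifs with hi
    · rw [hi]; simp
    · simp

omit h in
theorem derivative_X : C.derivative C.X = 1 :=
  C.ext _ _ fun i => by
    rw [C.coeff_derivative, C.coeff_X, C.coeff_one]
    by_cases hi : i = 0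
    · simp [hi]
    · simp [hi]

/-- The derivative of series as a derivation of the field `L`. -/
noncomputable def derivation : Derivation ℤ L L :=
  Derivation.mk' (AddMonoidHom.mk' C.derivative C.derivative_add).toIntLinearMap fun f g => by
    have := C.derivative_mul h f g
    rw [mul_comm (C.derivative f)] at this
    exact this

theorem derivation_apply (f : L) : C.derivation h f = C.derivative f := rfl

end Coordinates

/-! ### Frobenius and expansions over `p ^ s`-th powers -/

section Frobenius

variable {L : Type u} [Field L] {O : ValuationSubring L} {k : Subfield L} {ϖ : L} {p : ℕ}

theorem Setting.charP_residueField (h : Setting O k ϖ p) :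
    CharP (IsLocalRing.ResidueField O) p := by
  rw [CharP.charP_iff_prime_eq_zero h.prime, ← map_natCast (IsLocalRing.residue O),
    ← h.mem_powSubmodule_one_iff]
  simpa using h.p_mem

theorem Setting.sum_pow_sub_mem (h : Setting O k ϖ p) {ι : Type*} (S : Finset ι) {f : ι → L}
    (hf : ∀ i, f i ∈ O) (s : ℕ) :
    (∑ i ∈ S, f i) ^ p ^ s - ∑ i ∈ S, f i ^ p ^ s ∈ powSubmodule O ϖ 1 := by
  have := h.charP_residueField
  have : Fact p.Prime := ⟨h.prime⟩
  have h1 := (h.mem_powSubmodule_one_iff ((∑ i ∈ S, (⟨f i, hf i⟩ : O)) ^ p ^ s -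
    ∑ i ∈ S, (⟨f i, hf i⟩ : O) ^ p ^ s)).2 (by
      rw [map_sub, map_pow, map_sum, map_sum, sum_pow_char_pow]
      simp only [map_pow, sub_self])
  simpa using h1

/-- Frobenius is injective, hence surjective, on the finite residue field of `k`. The root is
exactly `0` when `a` vanishes modulo `ϖ`, so that roots of the coefficients of a series again form a
series. -/
theorem Setting.exists_root (h : Setting O k ϖ p) (s : ℕ) {a : L} (hak : a ∈ k) (haO : a ∈ O) :
    ∃ b ∈ k, b ∈ O ∧ b ^ p ^ s - a ∈ powSubmodule O ϖ 1 ∧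
      (a ∈ powSubmodule O ϖ 1 → b = 0) := by
  have := h.charP_residueField
  have : Fact p.Prime := ⟨h.prime⟩
  by_cases ha : a ∈ powSubmodule O ϖ 1
  · refine ⟨0, zero_mem _, zero_mem _, ?_, fun _ => rfl⟩
    rw [zero_pow (pow_ne_zero s h.prime.ne_zero), zero_sub]
    exact neg_mem ha
  let T : Set (IsLocalRing.ResidueField O) :=
    {y | ∃ a : O, (a : L) ∈ k ∧ IsLocalRing.residue O a = y}
  have hT : T.Finite := by
    obtain ⟨S, hS, hkS⟩ := h.finite
    classical
    refine (S.attach.image fun s : S => IsLocalRing.residue O ⟨s, (hS s s.2).2⟩).finite_toSet.subset ?_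
    rintro _ ⟨a, ha, rfl⟩
    obtain ⟨s, hs, has⟩ := hkS a ha a.2
    rw [Finset.coe_image]
    refine ⟨⟨s, hs⟩, by simp, ?_⟩
    rw [eq_comm, ← sub_eq_zero, ← map_sub, ← h.mem_powSubmodule_one_iff]
    exact has
  have : Finite T := hT.to_subtype
  let F : T → T := fun y => ⟨y ^ p ^ s, by
    obtain ⟨a, ha, hy⟩ := y.2
    exact ⟨a ^ p ^ s, by push_cast; exact pow_mem ha _, by rw [map_pow, hy]⟩⟩
  have hF : Function.Injective F := fun y z hyz =>
    Subtype.ext (iterateFrobenius_inj (IsLocalRing.ResidueField O) p s (congrArg Subtype.val hyz))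
  obtain ⟨⟨_, b, hb, rfl⟩, hby⟩ :=
    Finite.surjective_of_injective hF ⟨_, (⟨a, haO⟩ : O), hak, rfl⟩
  refine ⟨b, hb, b.2, ?_, fun h' => absurd h' ha⟩
  have hby' : IsLocalRing.residue O b ^ p ^ s = IsLocalRing.residue O ⟨a, haO⟩ :=
    congrArg Subtype.val hby
  rw [← map_pow, ← sub_eq_zero, ← map_sub, ← h.mem_powSubmodule_one_iff] at hby'
  simpa using hby'

end Frobenius

namespace Coordinates

variable {L : Type u} [Field L] {O : ValuationSubring L} {k : Subfield L} {ϖ : L} {p : ℕ}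
  (C : Coordinates O k ϖ)

/-- The elements of `O` without terms of negative degree. -/
def powerSeries (h : Setting O k ϖ p) : Subring L where
  carrier := {f | f ∈ O ∧ ∀ i < 0, C.coeff i f = 0}
  mul_mem' := fun {f g} hf hg => ⟨mul_mem hf.1 hg.1, fun i hi => by
    rw [C.coeff_mul_eq h.toIsUniformizer (S := ∅), Finset.sum_empty]
    intro r _
    rcases lt_or_ge r 0 with hr | hr
    · rw [hf.2 r hr, zero_mul]
    · rw [hg.2 _ (by omega), mul_zero]⟩
  one_mem' := ⟨one_mem _, fun i hi => by rw [C.coeff_one, if_neg hi.ne]⟩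
  add_mem' := fun hf hg => ⟨add_mem hf.1 hg.1,
    fun i hi => by rw [map_add, hf.2 i hi, hg.2 i hi, add_zero]⟩
  zero_mem' := ⟨zero_mem _, fun i _ => map_zero _⟩
  neg_mem' := fun hf => ⟨neg_mem hf.1, fun i hi => by rw [map_neg, hf.2 i hi, neg_zero]⟩

variable (h : Setting O k ϖ p)
include h

theorem X_mem_powerSeries : C.X ∈ C.powerSeries h :=
  ⟨C.X_mem h, fun i hi => by rw [C.coeff_X, if_neg (by omega)]⟩

theorem mul_mem_orderIdeal {f g : L} {M N : ℤ} {n : ℕ} (hf : f ∈ C.orderIdeal M n)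
    (hg : g ∈ C.orderIdeal N n) : f * g ∈ C.orderIdeal (M + N) n :=
  ⟨mul_mem hf.1 hg.1, fun i hi => C.coeff_mul_mem fun r => by
    rcases lt_or_ge r M with hr | hr
    · exact powSubmodule_mul_mem_left (hf.2 r hr) ((C.mem_iff h g).1 hg.1 _)
    · exact powSubmodule_mul_mem_right ((C.mem_iff h f).1 hf.1 _) (hg.2 _ (by omega))⟩

theorem pow_mem_orderIdeal {f : L} {N : ℤ} (hN : 0 ≤ N) (hf : f ∈ C.orderIdeal N 1) {n : ℕ}
    (hn : n ≠ 0) : f ^ n ∈ C.orderIdeal N 1 := by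
  obtain ⟨n, rfl⟩ := Nat.exists_eq_succ_of_ne_zero hn
  clear hn
  induction n with
  | zero => simpa using hf
  | succ n ih =>
    rw [pow_succ]
    have := C.mul_mem_orderIdeal h ih hf
    exact ⟨this.1, fun i hi => this.2 i (by omega)⟩

theorem sub_sum_mem_orderIdeal {f : L} (hf : f ∈ O) {M N : ℤ}
    (hM : ∀ i < M, C.coeff i f ∈ powSubmodule O ϖ 1) :
    f - ∑ i ∈ Finset.Ico M N, C.coeff i f * C.X ^ i ∈ C.orderIdeal N 1 := by
  refine ⟨sub_mem hf (sum_mem fun i _ => mul_mem ((C.mem_iff h f).1 hf i) (C.zpow_X_mem h i)),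
    fun i hi => ?_⟩
  rw [map_sub, map_sum]
  have : ∀ j, C.coeff i (C.coeff j f * C.X ^ j) = if j = i then C.coeff i f else 0 := by
    intro j
    rw [C.coeff_const_mul h.toIsUniformizer (C.coeff_mem j f), C.coeff_X_zpow h.toIsUniformizer]
    by_cases hij : j = i
    · simp [hij]
    · simp [hij, Ne.symm hij]
  simp only [this]
  rw [Finset.sum_ite_eq']
  split_ifs with hmem
  · rw [sub_self]; exact zero_mem _
  · rw [sub_zero]
    exact hM i (by by_contra! hle; exact hmem (Finset.mem_Ico.2 ⟨hle, hi⟩))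

/-- The coefficients of a `p ^ s`-th power modulo `ϖ`. -/
theorem coeff_pow_sub_mem {f : L} (hf : f ∈ O) (s : ℕ) (i : ℤ) :
    C.coeff i (f ^ p ^ s) - (if ((p ^ s : ℕ) : ℤ) ∣ i then
      C.coeff (i / (p ^ s : ℕ)) f ^ p ^ s else 0) ∈ powSubmodule O ϖ 1 := by
  have hu := h.toIsUniformizer
  have hq : 0 < p ^ s := pow_pos h.prime.pos s
  set q := p ^ s with hqdef
  obtain ⟨M₀, hM₀⟩ := C.tendsto f 1
  -- The window from `M` to `N` contains `i / q` when `q ∣ i`; below it the coefficients vanish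
  -- modulo `ϖ`, and the tail `v` starts beyond degree `i`, hence so does `v ^ q`.
  set M : ℤ := min M₀ (-|i|) with hM
  set N : ℤ := |i| + 1 with hN
  set v := f - ∑ j ∈ Finset.Ico M N, C.coeff j f * C.X ^ j with hv
  have hvN : v ∈ C.orderIdeal N 1 := C.sub_sum_mem_orderIdeal h hf fun j hj => hM₀ j (by omega)
  have hcO : ∀ j, C.coeff j f * C.X ^ j ∈ O := fun j =>
    mul_mem ((C.mem_iff h f).1 hf j) (C.zpow_X_mem h j)
  have hfrob : f ^ q - (v ^ q + ∑ j ∈ Finset.Ico M N, (C.coeff j f * C.X ^ j) ^ q) ∈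
      powSubmodule O ϖ 1 := by
    have h1 := h.sum_pow_sub_mem (Finset.insertNone (Finset.Ico M N))
      (f := fun o => o.elim v fun j => C.coeff j f * C.X ^ j)
      (fun o => by cases o; exacts [hvN.1, hcO _]) s
    rw [Finset.sum_insertNone, Finset.sum_insertNone] at h1
    simp only [Option.elim] at h1
    rwa [hv, sub_add_cancel] at h1
  have hvq := (C.pow_mem_orderIdeal h (by positivity) hvN hq.ne').2 i (by rw [hN]; have := le_abs_self i; omega)
  have h2 := add_mem ((C.mem_powSubmodule_iff h _ 1).1 hfrob i) hvq
  rw [map_sub, map_add, map_sum] at h2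
  have hterm : ∀ j, C.coeff i ((C.coeff j f * C.X ^ j) ^ q) =
      if j * q = i then C.coeff j f ^ q else 0 := by
    intro j
    rw [mul_pow, C.coeff_const_mul hu (pow_mem (C.coeff_mem j f) q), ← zpow_natCast (C.X ^ j) q,
      ← zpow_mul,       C.coeff_X_zpow hu]
    by_cases hij : j * q = i
    · simp [hij]
    · simp [hij, Ne.symm hij]
  simp only [hterm] at h2
  have hqz : (0 : ℤ) < q := by exact_mod_cast hq
  have hsum : (∑ j ∈ Finset.Ico M N, if j * q = i then C.coeff j f ^ q else 0) =
      if (q : ℤ) ∣ i then C.coeff (i / q) f ^ q else 0 := by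
    split_ifs with hdvd
    · obtain ⟨l, rfl⟩ := hdvd
      rw [Int.mul_ediv_cancel_left _ hqz.ne', Finset.sum_eq_single l]
      · rw [if_pos (mul_comm _ _)]
      · intro j _ hj
        rw [if_neg]
        intro h'
        rw [mul_comm] at h'
        exact hj (mul_left_cancel₀ hqz.ne' h')
      · intro hl
        exfalso
        apply hl
        have hle : |l| ≤ |(q : ℤ) * l| := by
          rw [abs_mul]
          have : (1 : ℤ) ≤ |(q : ℤ)| := by rw [abs_of_pos hqz]; omega
          nlinarith [abs_nonneg l]
        have h3 := neg_abs_le l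
        have h4 := le_abs_self l
        rw [Finset.mem_Ico]
        omega
    · refine Finset.sum_eq_zero fun j _ => if_neg fun h' => hdvd ⟨j, by rw [← h', mul_comm]⟩
  rw [hsum] at h2
  convert h2 using 1
  ring

/-- Modulo `ϖ` the powers `1, X, …, X ^ (p ^ s - 1)` generate `O` over its `p ^ s`-th powers. -/
theorem exists_pow_expansion (s : ℕ) {x : L} (hx : x ∈ O) :
    ∃ (g : ℕ → L) (y : L), (∀ j, g j ∈ O) ∧ y ∈ O ∧
      x = ∑ j ∈ Finset.range (p ^ s), g j ^ p ^ s * C.X ^ j + ϖ * y ∧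
      (x ∈ C.powerSeries h → (∀ j < p ^ s, g j ∈ C.powerSeries h) ∧ y ∈ C.powerSeries h) := by
  have hu := h.toIsUniformizer
  have hq : 0 < p ^ s := pow_pos h.prime.pos s
  have hxc := (C.mem_iff h x).1 hx
  choose ρ hρk hρO hρ hρ0 using fun i => h.exists_root s (C.coeff_mem i x) (hxc i)
  set q := p ^ s with hqdef
  have hqz : (0 : ℤ) < q := by exact_mod_cast hq
  obtain ⟨N, hN⟩ := C.tendsto x 1
  -- `g j` collects the roots of the coefficients of `x` in the degrees `q * m + j`.
  choose g hg using fun j : ℕ => C.exists_eq (fun m => ρ (q * m + j)) (fun m => hρk _)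
    ⟨0, fun m => by simpa using hρO _⟩ (fun n => ⟨-|N| - j, fun m hm => by
      have h1 := neg_abs_le N
      have h0 := abs_nonneg N
      have hle : (q : ℤ) * m + j ≤ N := by nlinarith
      rw [hρ0 _ (hN _ hle)]
      exact zero_mem _⟩)
  have hgO : ∀ j, g j ∈ O := fun j => (C.mem_iff h _).2 fun m => by rw [hg]; exact hρO _
  have hdiff : x - ∑ j ∈ Finset.range q, g j ^ q * C.X ^ j ∈ powSubmodule O ϖ 1 := by
    rw [C.mem_powSubmodule_iff h]
    intro i
    have h1 : ∑ j ∈ Finset.range q, (C.coeff (i - j) (g j ^ q) - (if (q : ℤ) ∣ i - j then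
      C.coeff ((i - j) / q) (g j) ^ q else 0)) ∈ powSubmodule O ϖ 1 :=
      sum_mem fun j _ => C.coeff_pow_sub_mem h (hgO j) s (i - j)
    rw [Finset.sum_sub_distrib] at h1
    have hmod := Int.emod_add_mul_ediv i q
    have hmod0 := Int.emod_nonneg i hqz.ne'
    have hmodlt := Int.emod_lt_of_pos i hqz
    have h2 : (∑ j ∈ Finset.range q, if (q : ℤ) ∣ i - j then
      C.coeff ((i - j) / q) (g j) ^ q else 0) = ρ i ^ q := by
      rw [Finset.sum_eq_single (i % q).toNat]
      · have e1 : i - ((i % q).toNat : ℤ) = q * (i / q) := by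
          rw [Int.toNat_of_nonneg hmod0]; omega
        rw [e1, if_pos (dvd_mul_right _ _), Int.mul_ediv_cancel_left _ hqz.ne', hg,
          Int.toNat_of_nonneg hmod0, add_comm, hmod]
      · intro j hj hne
        rw [if_neg]
        intro hdvd
        apply hne
        have : i % q = j % q := Int.emod_eq_emod_iff_emod_sub_eq_zero.2 (Int.emod_eq_zero_of_dvd hdvd)
        rw [this, Int.emod_eq_of_lt (by omega) (by exact_mod_cast Finset.mem_range.1 hj)]
        simp
      · intro hne
        exfalso
        apply hne
        rw [Finset.mem_range]
        omega
    rw [h2] at h1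
    have h3 := add_mem h1 (hρ i)
    rw [← neg_mem_iff] at h3
    convert h3 using 1
    rw [map_sub, map_sum]
    simp only [mul_comm (_ ^ q) (C.X ^ _), C.coeff_X_pow_mul hu]
    ring
  obtain ⟨y, hy, hxy⟩ := hdiff
  rw [pow_one] at hxy
  refine ⟨g, y, hgO, hy, by rw [← hxy]; ring, fun hxP => ?_⟩
  have hgP : ∀ j < q, g j ∈ C.powerSeries h := fun j hj => ⟨hgO j, fun m hm => by
    have hneg : (q : ℤ) * m + j < 0 := by nlinarith
    rw [hg, hρ0 _ (by rw [hxP.2 _ hneg]; exact zero_mem _)]⟩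
  refine ⟨hgP, hy, fun i hi => ?_⟩
  have hd : x - ∑ j ∈ Finset.range q, g j ^ q * C.X ^ j ∈ C.powerSeries h :=
    sub_mem hxP (sum_mem fun j hj => mul_mem (pow_mem (hgP j (Finset.mem_range.1 hj)) _)
      (pow_mem (C.X_mem_powerSeries h) _))
  rw [hxy] at hd
  have := hd.2 i hi
  rw [C.coeff_const_mul hu h.mem_k] at this
  exact (mul_eq_zero.1 this).resolve_left h.ne_zero

end Coordinates

/-! ### Congruences between `p`-th powers and logarithmic derivatives -/

section Congruences

variable {L : Type u} [Field L] {O : ValuationSubring L} {k : Subfield L} {ϖ : L} {p : ℕ}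

/-- For `a` divisible by `ϖ ^ (s + 1)`, the difference `(a + b) ^ p - b ^ p = a ^ p + p * a * b * r`
gains a factor `ϖ`: in the first term since `(s + 1) * p ≥ s + 2`, in the second since `ϖ ∣ p`. -/
theorem Setting.pow_sub_pow_mem (h : Setting O k ϖ p) {x y : L} (hx : x ∈ O) (hy : y ∈ O)
    (hxy : x - y ∈ powSubmodule O ϖ 1) (s : ℕ) :
    x ^ p ^ s - y ^ p ^ s ∈ powSubmodule O ϖ (s + 1) := by
  induction s with
  | zero => simpa using hxy
  | succ s ih =>
    set a : O := ⟨x, hx⟩ ^ p ^ s - ⟨y, hy⟩ ^ p ^ s with ha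
    set b : O := ⟨y, hy⟩ ^ p ^ s with hb
    have haL : (a : L) ∈ powSubmodule O ϖ (s + 1) := by
      rw [ha, hb]; push_cast; exact ih
    obtain ⟨r, hr⟩ := exists_add_pow_prime_eq h.prime a b
    have hrL := congrArg (fun z : O => (z : L)) hr
    simp only [ha, hb, sub_add_cancel] at hrL
    push_cast at hrL
    rw [← pow_mul, ← pow_mul, ← pow_succ] at hrL
    have hmain : x ^ p ^ (s + 1) - y ^ p ^ (s + 1) = (a : L) ^ p + p * (a : L) * b * r := by
      rw [hrL, ha, hb]
      push_cast
      ring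
    rw [hmain]
    refine add_mem ?_ (powSubmodule_mul_mem_left (powSubmodule_mul_mem_left ?_ b.2) r.2)
    · obtain ⟨c, hc, hac⟩ := haL
      rw [hac, mul_pow, ← pow_mul]
      refine h.powSubmodule_anti (m := s + 1 + 1) (n := (s + 1) * p) ?_ ⟨c ^ p, pow_mem hc p, rfl⟩
      nlinarith [h.prime.two_le]
    · rw [add_comm (s + 1) 1]
      exact powSubmodule_mul_mem h.p_mem haL

/-- Choose `c` with `p ∣ ϖ ^ c`: after `c` steps the congruence holds modulo `p`, and each further
`p`-th power gains a factor `p`. -/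
theorem Setting.exists_pow_sub_pow_eq (h : Setting O k ϖ p) :
    ∃ c : ℕ, ∀ s : ℕ, ∀ x ∈ O, ∀ y ∈ O, x - y ∈ powSubmodule O ϖ 1 →
      ∃ w ∈ O, x ^ p ^ (c + s) = y ^ p ^ (c + s) + (p : L) ^ s * w := by
  have := h.charZero
  have hp0 : (p : L) ≠ 0 := by exact_mod_cast h.prime.ne_zero
  obtain ⟨c, hc⟩ := h.exists_pow_mul_mem (p : L)⁻¹
  refine ⟨c, fun s x hx y hy hxy => ?_⟩
  have h1 := h.powSubmodule_anti (Nat.le_succ c) (h.pow_sub_pow_mem hx hy hxy c)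
  obtain ⟨z, hz, hxz⟩ := h1
  have h2 : (p : O) ∣ (⟨x, hx⟩ : O) ^ p ^ c - (⟨y, hy⟩ : O) ^ p ^ c := by
    refine ⟨⟨_, hc⟩ * ⟨z, hz⟩, Subtype.ext ?_⟩
    push_cast
    rw [hxz]
    field_simp
  obtain ⟨w, hw⟩ := dvd_sub_pow_of_dvd_sub h2 s
  refine ⟨p * w, mul_mem (natCast_mem _ _) w.2, ?_⟩
  have h3 := congrArg (fun z : O => (z : L)) hw
  push_cast at h3
  rw [← pow_mul, ← pow_mul, ← pow_add] at h3
  linear_combination h3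

namespace Coordinates

variable (C : Coordinates O k ϖ)

theorem orderIdeal_anti {M N : ℤ} (hMN : M ≤ N) {n : ℕ} :
    C.orderIdeal N n ≤ C.orderIdeal M n :=
  fun _ hf => ⟨hf.1, fun i hi => hf.2 i (hi.trans_le hMN)⟩

theorem exists_mem_orderIdeal {f : L} (hf : f ∈ O) (n : ℕ) : ∃ N, f ∈ C.orderIdeal N n := by
  obtain ⟨N, hN⟩ := C.tendsto f n
  exact ⟨N, hf, fun i hi => hN i hi.le⟩

variable (h : Setting O k ϖ p)
include h

theorem mem_orderIdeal_of_mem_powSubmodule {f : L} {n : ℕ} (hf : f ∈ powSubmodule O ϖ n) (N : ℤ) :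
    f ∈ C.orderIdeal N n :=
  ⟨h.powSubmodule_le hf, fun i _ => (C.mem_powSubmodule_iff h f n).1 hf i⟩

theorem powerSeries_le_orderIdeal {f : L} (hf : f ∈ C.powerSeries h) (n : ℕ) :
    f ∈ C.orderIdeal 0 n :=
  ⟨hf.1, fun i hi => by rw [hf.2 i hi]; exact zero_mem _⟩

theorem exists_powerSeries_sub_mem {f : L} (hf : f ∈ C.orderIdeal 0 1) :
    ∃ a ∈ C.powerSeries h, f - a ∈ powSubmodule O ϖ 1 := by
  have hfc := (C.mem_iff h f).1 hf.1
  obtain ⟨a, ha⟩ := C.exists_eq (fun i => if i < 0 then 0 else C.coeff i f)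
    (fun i => by split_ifs; exacts [zero_mem _, C.coeff_mem i f])
    ⟨0, fun i => by rw [pow_zero, one_mul]; split_ifs; exacts [zero_mem _, hfc i]⟩
    (fun n => ⟨-1, fun i hi => by rw [if_pos (by omega)]; exact zero_mem _⟩)
  refine ⟨a, ⟨(C.mem_iff h a).2 fun i => ?_, fun i hi => by rw [ha, if_pos hi]⟩,
    (C.mem_powSubmodule_iff h _ 1).2 fun i => ?_⟩
  · rw [ha]; split_ifs; exacts [zero_mem _, hfc i]
  · rw [map_sub, ha]
    split_ifs with hi
    · rw [sub_zero]; exact hf.2 i hi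
    · rw [sub_self]; exact zero_mem _

theorem derivative_mem_powerSeries {f : L} (hf : f ∈ C.powerSeries h) :
    C.derivative f ∈ C.powerSeries h :=
  ⟨C.derivative_mem h hf.1, fun i hi => by
    rw [C.coeff_derivative]
    rcases eq_or_lt_of_le (show i ≤ -1 by omega) with rfl | hi'
    · simp
    · rw [hf.2 _ (by omega), mul_zero]⟩

theorem derivative_pow (f : L) (n : ℕ) :
    C.derivative (f ^ n) = n * (f ^ (n - 1) * C.derivative f) := by
  have := (C.derivation h).leibniz_pow f n
  rw [C.derivation_apply, C.derivation_apply, nsmul_eq_mul, smul_eq_mul] at this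
  exact this

theorem coeff_neg_one_derivative_mul (f g : L) :
    C.coeff (-1) (C.derivative f * g) = -C.coeff (-1) (f * C.derivative g) := by
  have := C.coeff_derivative_neg_one (f * g)
  rw [C.derivative_mul h, map_add] at this
  linear_combination this

/-- The residue of the logarithmic derivative of a unit of order zero. -/
theorem coeff_neg_one_logDeriv {u : L} (hu : C.HasOrder u 0) :
    C.coeff (-1) (C.derivative u / u) = 0 := by
  have := h.charZero
  have hun := h.toIsUniformizer
  have hp0 : (p : L) ≠ 0 := by exact_mod_cast h.prime.ne_zero
  have hu0 := hu.ne_zero C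
  have hui := C.inv_hasOrder_zero h hu
  have huO := (C.mem_iff h u).2 hu.1
  have huiO := (C.mem_iff h _).2 hui.1
  obtain ⟨a, ha, hua⟩ := C.exists_powerSeries_sub_mem h ⟨huO, hu.2.2⟩
  obtain ⟨b, hb, hub⟩ := C.exists_powerSeries_sub_mem h ⟨huiO, hui.2.2⟩
  obtain ⟨c, hc⟩ := h.exists_pow_sub_pow_eq
  set r := C.coeff (-1) (C.derivative u / u) with hr
  have hcO : ∀ {f : L}, f ∈ O → C.coeff (-1) f ∈ O := fun hf => (C.mem_iff h _).1 hf _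
  have hpk : ∀ n : ℕ, (p : L) ^ n ∈ k := fun n => pow_mem (natCast_mem _ _) n
  have hpO : ∀ n : ℕ, (p : L) ^ n ∈ O := fun n => pow_mem (natCast_mem _ _) n
  -- With `q = p ^ (c + s)`, write `q du/u = d(u ^ q) u ^ (-q)` and insert `u ^ q = a ^ q + p ^ s
  -- w`, `u ^ (-q) = b ^ q + p ^ s w'`. The power series part has no residue; the other terms have
  -- residues divisible by `p ^ (2 s)`, the one in `dw · b ^ q` after integrating by parts.
  -- Cancelling `p ^ s` gives the claim.
  have key : ∀ s : ℕ, ∃ z ∈ O, (p : L) ^ c * r = p ^ s * z := by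
    intro s
    obtain ⟨w, hw, huw⟩ := hc s u huO a ha.1 hua
    obtain ⟨w', hw', huw'⟩ := hc s u⁻¹ huiO b hb.1 hub
    set q := p ^ (c + s) with hq
    set α := a ^ (q - 1) * C.derivative a with hα
    set β := b ^ (q - 1) * C.derivative b with hβ
    have hαP : α ∈ C.powerSeries h :=
      mul_mem (pow_mem ha _) (C.derivative_mem_powerSeries h ha)
    have hβP : β ∈ C.powerSeries h :=
      mul_mem (pow_mem hb _) (C.derivative_mem_powerSeries h hb)
    have hqL : ((q : ℕ) : L) = (p : L) ^ c * p ^ s := by rw [hq]; push_cast; ring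
    have hd1 : (q : L) * (C.derivative u / u) = C.derivative (u ^ q) * u⁻¹ ^ q := by
      rw [C.derivative_pow h]
      have hq1 : u ^ q = u ^ (q - 1) * u := by
        rw [← pow_succ, Nat.sub_add_cancel]
        exact Nat.pos_of_ne_zero (pow_ne_zero _ h.prime.ne_zero)
      rw [inv_pow, hq1]
      field_simp
    have hd2 : C.derivative (u ^ q) = q * α + p ^ s * C.derivative w := by
      rw [huw, C.derivative_add, C.derivative_pow h, C.derivative_mul h,
        C.derivative_const (hpk s)]
      ring
    have hd3 : C.coeff (-1) (α * b ^ q) = 0 := (mul_mem hαP (pow_mem hb q)).2 _ (by norm_num)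
    have hd4 : C.coeff (-1) (C.derivative w * b ^ q) = -(q * C.coeff (-1) (w * β)) := by
      rw [C.coeff_neg_one_derivative_mul h, C.derivative_pow h, mul_left_comm,
        C.coeff_const_mul hun (natCast_mem _ _)]
    have hexp : (q : L) * (C.derivative u / u) = q * (α * b ^ q) + (q * p ^ s) * (α * w') +
        p ^ s * (C.derivative w * b ^ q) + p ^ (s + s) * (C.derivative w * w') := by
      rw [hd1, hd2, huw']
      ring
    have hcoef := congrArg (C.coeff (-1)) hexp
    rw [map_add, map_add, map_add, C.coeff_const_mul hun (natCast_mem _ _),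
      C.coeff_const_mul hun (natCast_mem _ _),
      C.coeff_const_mul hun (mul_mem (natCast_mem _ _) (hpk s)),
      C.coeff_const_mul hun (hpk s), C.coeff_const_mul hun (hpk _), hd3, hd4, ← hr] at hcoef
    refine ⟨p ^ c * C.coeff (-1) (α * w') - p ^ c * C.coeff (-1) (w * β) +
      C.coeff (-1) (C.derivative w * w'), ?_, ?_⟩
    · exact add_mem (sub_mem (mul_mem (hpO _) (hcO (mul_mem hαP.1 hw')))
        (mul_mem (hpO _) (hcO (mul_mem hw hβP.1)))) (hcO (mul_mem (C.derivative_mem h hw) hw'))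
    · have hps : (p : L) ^ s ≠ 0 := pow_ne_zero s hp0
      refine mul_left_cancel₀ hps ?_
      rw [hqL] at hcoef
      linear_combination hcoef
  have hz : (p : L) ^ c * r = 0 := h.haus _ fun n => by
    obtain ⟨z, hz, hrz⟩ := key n
    rw [hrz]
    exact powSubmodule_mul_mem_left (pow_mem_powSubmodule h.p_mem) hz
  exact (mul_eq_zero.1 hz).resolve_left (pow_ne_zero c hp0)

end Coordinates

end Congruences

/-! ### Change of variable and invariance of the residue -/

namespace Coordinates

variable {L : Type u} [Field L] {O : ValuationSubring L} {k : Subfield L} {ϖ : L} {p : ℕ}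
  (C : Coordinates O k ϖ) (h : Setting O k ϖ p)
include h

theorem pow_mem_orderIdeal_mul {f : L} {N : ℤ} {n : ℕ} (hf : f ∈ C.orderIdeal N n) (m : ℕ) :
    f ^ m ∈ C.orderIdeal (m * N) n := by
  induction m with
  | zero =>
    simpa using C.powerSeries_le_orderIdeal h (one_mem _) n
  | succ m ih =>
    rw [pow_succ]
    have := C.mul_mem_orderIdeal h ih hf
    push_cast
    rwa [add_mul, one_mul]

variable {A : ValuationSubring (IsLocalRing.ResidueField O)} (hA : IsCompleteDVR A)
  (C' : Coordinates O k ϖ)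
include hA

/-- Power series in another variable have coefficients which are small in small degrees,
uniformly. -/
theorem exists_powerSeries_le_orderIdeal (n : ℕ) :
    ∃ M : ℤ, ∀ f ∈ C'.powerSeries h, f ∈ C.orderIdeal M n := by
  induction n with
  | zero => exact ⟨0, fun f hf => ⟨hf.1, fun i _ => mem_powSubmodule_zero.2
      ((C.mem_iff h f).1 hf.1 i)⟩⟩
  | succ n ih =>
    obtain ⟨M, hM⟩ := ih
    choose N hN using fun j : ℕ => C.exists_mem_orderIdeal (pow_mem (C'.X_mem h) j) (n + 1)
    obtain ⟨B, hB⟩ := ((Finset.range (p ^ n)).image fun j => -N j).exists_le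
    refine ⟨min M (-B), fun f hf => ?_⟩
    obtain ⟨g, y, hg, hy, hfg, hP⟩ := C'.exists_pow_expansion h n hf.1
    obtain ⟨hgP, hyP⟩ := hP hf
    rw [hfg]
    refine add_mem (sum_mem fun j hj => ?_) ?_
    · have hj' := hgP j (Finset.mem_range.1 hj)
      have hres : IsLocalRing.residue O ⟨g j, hg j⟩ ∈ A :=
        (C'.residue_mem_iff h hA _).2 fun i hi => by
          change C'.coeff i (g j) ∈ _
          rw [hj'.2 i hi]; exact zero_mem _
      rw [C.residue_mem_iff h hA] at hres
      -- Modulo `ϖ`, `g j` is also a power series `a` in the variable of `C`; so modulo `ϖ ^ (n +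
      -- 1)` its `p ^ n`-th power is `a ^ (p ^ n)`, and only the finitely many powers of `C'.X`
      -- matter for the bound.
      obtain ⟨a, ha, hga⟩ := C.exists_powerSeries_sub_mem h ⟨hg j, hres⟩
      have h1 := C.mem_orderIdeal_of_mem_powSubmodule h
        (h.pow_sub_pow_mem (hg j) ha.1 hga n) 0
      have h2 := add_mem h1 (C.powerSeries_le_orderIdeal h (pow_mem ha (p ^ n)) (n + 1))
      rw [sub_add_cancel] at h2
      have h3 := C.mul_mem_orderIdeal h h2 (hN j)
      have := hB _ (Finset.mem_image_of_mem _ hj)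
      exact C.orderIdeal_anti (by omega) h3
    · have hyM := hM y hyP
      refine C.orderIdeal_anti (min_le_left _ _) ⟨mul_mem h.mem hy, fun i hi => ?_⟩
      rw [C.coeff_const_mul h.toIsUniformizer h.mem_k, add_comm n 1]
      have := (h.mul_mem_powSubmodule_add_iff (m := 1)).2 (hyM.2 i hi)
      rwa [pow_one] at this

/-- Modulo `ϖ` the new variable is `C.X * a` with `a` a power series, so modulo `ϖ ^ (n + 1)` its `p
^ n`-th power starts in degree at least `1`; raise this to the power `m`. -/
theorem X_pow_mem_orderIdeal (n m : ℕ) :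
    C'.X ^ (p ^ n * m) ∈ C.orderIdeal m (n + 1) := by
  have hu := C.hasOrder_X_div_X h hA C'
  have hq : 0 < p ^ n := pow_pos h.prime.pos n
  obtain ⟨a, ha, hua⟩ := C.exists_powerSeries_sub_mem h ⟨(C.mem_iff h _).2 hu.1, hu.2.2⟩
  have h1 : C'.X - C.X * a ∈ powSubmodule O ϖ 1 := by
    have := powSubmodule_mul_mem_right (C.X_mem h) hua
    rwa [mul_sub, mul_div_cancel₀ _ C.X_ne_zero] at this
  have hX1 : C.X ∈ C.orderIdeal 1 (n + 1) :=
    ⟨C.X_mem h, fun i hi => by rw [C.coeff_X, if_neg hi.ne]; exact zero_mem _⟩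
  have h2 := C.mem_orderIdeal_of_mem_powSubmodule h
    (h.pow_sub_pow_mem (C'.X_mem h) (mul_mem (C.X_mem h) ha.1) h1 n) 1
  have h3 := C.mul_mem_orderIdeal h hX1 (C.powerSeries_le_orderIdeal h ha (n + 1))
  have h4 := C.pow_mem_orderIdeal_mul h h3 (p ^ n)
  have h5 := add_mem h2 (C.orderIdeal_anti (M := 1) (by
    have : (1 : ℤ) ≤ (p ^ n : ℕ) := by exact_mod_cast hq
    simpa using this) h4)
  rw [sub_add_cancel] at h5
  rw [pow_mul]
  simpa using C.pow_mem_orderIdeal_mul h h5 m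

/-- For `i ≠ -1` the form is exact after multiplication by `i + 1`. For `i = -1`, with `u = C'.X /
C.X`, it is `dX/X + du/u`, and `coeff_neg_one_logDeriv` applies. -/
theorem coeff_neg_one_zpow_mul_derivative (i : ℤ) :
    C.coeff (-1) (C'.X ^ i * C.derivative C'.X) = C'.coeff (-1) (C'.X ^ i) := by
  have := h.charZero
  rw [C'.coeff_X_zpow h.toIsUniformizer]
  by_cases hi : i = -1
  · rw [if_pos hi.symm, hi]
    have hu := C.hasOrder_X_div_X h hA C'
    have hX : C'.X = C.X * (C'.X / C.X) := (mul_div_cancel₀ _ C.X_ne_zero).symm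
    have hd : C'.X ^ (-1 : ℤ) * C.derivative C'.X =
        C.X ^ (-1 : ℤ) + C.derivative (C'.X / C.X) / (C'.X / C.X) := by
      have h0 := C.X_ne_zero
      have h1 := C'.X_ne_zero
      have h2 := C.derivative_mul h C.X (C'.X / C.X)
      rw [← hX, C.derivative_X] at h2
      rw [h2]
      field_simp
      ring
    rw [hd, map_add, C.coeff_neg_one_logDeriv h hu, C.coeff_X_zpow h.toIsUniformizer]
    simp
  · rw [if_neg (Ne.symm hi)]
    have h1 := (C.derivation h).leibniz_zpow C'.X (i + 1)
    rw [add_sub_cancel_right, C.derivation_apply, C.derivation_apply, zsmul_eq_mul,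
      smul_eq_mul] at h1
    have h2 := C.coeff_derivative_neg_one (C'.X ^ (i + 1))
    rw [h1, C.coeff_const_mul h.toIsUniformizer (intCast_mem _ _)] at h2
    refine (mul_eq_zero.1 h2).resolve_left ?_
    rw [Int.cast_eq_zero]
    omega

/-- The residue does not depend on the coordinates. -/
theorem coeff_neg_one_mul_derivative (f : L) :
    C.coeff (-1) (f * C.derivative C'.X) = C'.coeff (-1) f := by
  have hun := h.toIsUniformizer
  rw [← sub_eq_zero]
  let l : L →+ L := ((C.coeff (-1)).comp (AddMonoidHom.mulRight (C.derivative C'.X))) -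
    C'.coeff (-1)
  change l f = 0
  have hl : ∀ f, l f = C.coeff (-1) (f * C.derivative C'.X) - C'.coeff (-1) f := fun f => rfl
  have hlk : ∀ c ∈ k, ∀ f, l (c * f) = c * l f := by
    intro c hc f
    rw [hl, hl, mul_assoc, C.coeff_const_mul hun hc, C'.coeff_const_mul hun hc, mul_sub]
  have hdO : C.derivative C'.X ∈ O := C.derivative_mem h (C'.X_mem h)
  have hO : ∀ f ∈ O, l f = 0 := by
    intro f hf
    refine h.haus _ fun n => ?_
    obtain ⟨M, hM⟩ := C.exists_powerSeries_le_orderIdeal h hA C' (n + 1)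
    obtain ⟨D, hD⟩ := C.exists_mem_orderIdeal hdO (n + 1)
    obtain ⟨B, hB⟩ := C'.tendsto f (n + 1)
    -- Modulo `ϖ ^ (n + 1)` the product of `C'.X ^ N`, a power series in `C'.X` and `dX'/dX` starts
    -- in degree `m + M + D ≥ 0`, hence has no residue.
    set m : ℕ := M.natAbs + D.natAbs with hm
    set N : ℕ := p ^ n * m with hN
    -- `g` is the part of `f` in degrees `≥ N`, divided by `C'.X ^ N`.
    obtain ⟨g, hg⟩ := C'.exists_eq (fun i => if i < 0 then 0 else C'.coeff (i + N) f)
      (fun i => by split_ifs; exacts [zero_mem _, C'.coeff_mem _ f])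
      ⟨0, fun i => by
        rw [pow_zero, one_mul]; split_ifs; exacts [zero_mem _, (C'.mem_iff h f).1 hf _]⟩
      (fun n => ⟨-1, fun i hi => by rw [if_pos (by omega)]; exact zero_mem _⟩)
    have hgP : g ∈ C'.powerSeries h :=
      ⟨(C'.mem_iff h g).2 fun i => by
        rw [hg]; split_ifs; exacts [zero_mem _, (C'.mem_iff h f).1 hf _],
        fun i hi => by rw [hg, if_pos hi]⟩
    set S := ∑ i ∈ Finset.Ico B N, C'.coeff i f * C'.X ^ i with hS
    have hrest : f - S - C'.X ^ N * g ∈ powSubmodule O ϖ (n + 1) := by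
      rw [C'.mem_powSubmodule_iff h]
      intro i
      have hc : ∀ j, C'.coeff i (C'.coeff j f * C'.X ^ j) = if j = i then C'.coeff i f else 0 := by
        intro j
        rw [C'.coeff_const_mul hun (C'.coeff_mem j f), C'.coeff_X_zpow hun]
        by_cases hij : j = i
        · simp [hij]
        · simp [hij, Ne.symm hij]
      rw [map_sub, map_sub, hS, map_sum, C'.coeff_X_pow_mul hun, hg]
      simp only [hc]
      rw [Finset.sum_ite_eq', sub_add_cancel]
      by_cases hiN : i < N
      · rw [if_pos (show i - N < 0 by omega), sub_zero]
        split_ifs with hmem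
        · rw [sub_self]; exact zero_mem _
        · rw [sub_zero]
          exact hB i (by by_contra! hlt; exact hmem (Finset.mem_Ico.2 ⟨hlt.le, hiN⟩))
      · rw [if_neg (show ¬ i - N < 0 by omega), if_neg fun hmem => hiN (Finset.mem_Ico.1 hmem).2]
        simp
    have hf' : f = S + C'.X ^ N * g + (f - S - C'.X ^ N * g) := by ring
    rw [hf', map_add, map_add]
    have hlS : l S = 0 := by
      rw [hS, map_sum]
      refine Finset.sum_eq_zero fun i _ => ?_
      rw [hlk _ (C'.coeff_mem i f), hl, C.coeff_neg_one_zpow_mul_derivative h hA C', sub_self,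
        mul_zero]
    rw [hlS, zero_add]
    refine h.powSubmodule_anti (Nat.le_succ n) (add_mem ?_ ?_)
    · rw [hl]
      refine sub_mem ?_ ?_
      · have h1 := C.mul_mem_orderIdeal h
          (C.mul_mem_orderIdeal h (C.X_pow_mem_orderIdeal h hA C' n m) (hM g hgP)) hD
        exact h1.2 _ (by omega)
      · rw [C'.coeff_X_pow_mul hun, hgP.2 _ (by omega)]
        exact zero_mem _
    · rw [hl]
      exact sub_mem ((C.mem_powSubmodule_iff h _ _).1 (powSubmodule_mul_mem_left hrest hdO) _)
        ((C'.mem_powSubmodule_iff h _ _).1 hrest _)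
  obtain ⟨n, hn⟩ := h.exists_pow_mul_mem f
  have := hO _ hn
  rw [hlk _ (pow_mem h.mem_k n)] at this
  exact (mul_eq_zero.1 this).resolve_left (pow_ne_zero n h.ne_zero)

end Coordinates

/-! ### Derivations into separated modules -/

section Derivations

variable {L : Type u} [Field L] {O : ValuationSubring L} {ϖ : L} {p : ℕ}
  {N : Type*} [AddCommGroup N] [Module O N]

/-- A derivation into a separated module vanishes on the `p`-adic numbers. -/
theorem Setting.derivation_padic {k : Subfield L} (h : Setting O k ϖ p)
    (hN : ∀ y : N, (∀ n : ℕ, ∃ z : N, y = (⟨ϖ, h.mem⟩ : O) ^ n • z) → y = 0)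
    (D : Derivation ℤ O N) {x : O} (hx : (x : L) ∈ padicSubfield O) : D x = 0 := by
  have := h.charZero
  refine hN _ fun n => ?_
  -- Precision `n + 1`, because differentiating `ϖ ^ (n + 1) * w` loses one power of `ϖ`.
  obtain ⟨q, hq, w, hw, hxq⟩ := h.exists_rat hx (n + 1)
  have hqO : q ∈ O := by
    have : q = x - ϖ ^ (n + 1) * w := by rw [← hxq]; ring
    rw [this]
    exact sub_mem x.2 (mul_mem (pow_mem h.mem _) hw)
  obtain ⟨a, b, hb0, hb, hqab⟩ := exists_int_div hq hqO
  have hDint : ∀ m : ℤ, D (m : O) = 0 := fun m => D.map_algebraMap m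
  have hDq : D ⟨q, hqO⟩ = 0 := by
    have h1 : (b : O) * ⟨q, hqO⟩ = a := Subtype.ext (by push_cast; rw [hqab]; field_simp)
    have h2 := congrArg D h1
    rw [D.leibniz, hDint, hDint, smul_zero, add_zero] at h2
    have h3 : (⟨_, hb⟩ : O) * (b : O) = 1 := Subtype.ext (by push_cast; field_simp)
    rw [← one_smul O (D _), ← h3, mul_smul, h2, smul_zero]
  have hx' : x = ⟨q, hqO⟩ + (⟨ϖ, h.mem⟩ : O) ^ (n + 1) * ⟨w, hw⟩ :=
    Subtype.ext (by push_cast; rw [← hxq]; ring)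
  refine ⟨(⟨ϖ, h.mem⟩ : O) • D ⟨w, hw⟩ + ((n + 1 : ℕ) * (⟨w, hw⟩ : O)) • D ⟨ϖ, h.mem⟩, ?_⟩
  conv_lhs => rw [hx']
  rw [map_add, hDq, zero_add, D.leibniz, D.leibniz_pow, Nat.add_sub_cancel, smul_add, smul_smul,
    smul_smul, ← pow_succ, ← Nat.cast_smul_eq_nsmul O, smul_smul, smul_smul]
  congr 2
  ring

theorem exists_aeval_eq_zero {x : O} (hx : (x : L) ∈ constantField O) :
    ∃ f : Polynomial (baseRing O (padicSubfield O)), f ≠ 0 ∧ Polynomial.aeval x f = 0 := by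
  obtain ⟨f, hfO, ⟨i, hi⟩, hf⟩ := exists_primitive_polynomial O hx
  let z : ℕ → baseRing O (padicSubfield O) := fun j => ⟨⟨f.coeff j, hfO j⟩, (f.coeff j).2⟩
  refine ⟨∑ j ∈ f.support, Polynomial.C (z j) * Polynomial.X ^ j, fun h0 => ?_, ?_⟩
  · have h1 := congrArg (fun g => Polynomial.coeff g i) h0
    have hmem : i ∈ f.support := by rw [Polynomial.mem_support_iff, hi]; exact one_ne_zero
    simp only [Polynomial.finsetSum_coeff, Polynomial.coeff_C_mul, Polynomial.coeff_X_pow,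
      mul_ite, mul_one, mul_zero, Finset.sum_ite_eq, if_pos hmem, Polynomial.coeff_zero] at h1
    have h2 : (f.coeff i : L) = 0 := congrArg (fun w : baseRing O (padicSubfield O) => ((w : O) : L)) h1
    rw [hi] at h2
    exact one_ne_zero h2
  · refine Subtype.ext ?_
    rw [Polynomial.aeval_def, Polynomial.eval₂_eq_sum, Polynomial.sum] at hf
    rw [map_sum]
    simp only [map_mul, map_pow, Polynomial.aeval_C, Polynomial.aeval_X]
    push_cast
    exact hf

/-- A derivation into a separated module is torsion on the algebraic elements. -/
theorem Setting.exists_smul_derivation_eq_zero (h : Setting O (constantField O) ϖ p)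
    (hN : ∀ y : N, (∀ n : ℕ, ∃ z : N, y = (⟨ϖ, h.mem⟩ : O) ^ n • z) → y = 0)
    (D : Derivation ℤ O N) {x : O} (hx : (x : L) ∈ constantField O) :
    ∃ c : O, c ≠ 0 ∧ c • D x = 0 := by
  classical
  have := h.charZero
  let Z := baseRing O (padicSubfield O)
  have hZ : ∀ z : Z, D z = 0 := fun z => h.derivation_padic hN D z.2
  let DZ : Derivation Z O N := Derivation.mk'
    { toFun := D
      map_add' := D.map_add
      map_smul' := fun z y => by
        change D ((z : O) * y) = (z : O) • D y
        rw [D.leibniz, hZ, smul_zero, add_zero] } D.leibniz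
  -- Take `f` of least degree killing `x`; then `f'(x) ≠ 0` in characteristic zero, while `f'(x) • D
  -- x = D (f(x)) = 0`.
  have hex : ∃ d : ℕ, ∃ f : Polynomial Z, f ≠ 0 ∧ Polynomial.aeval x f = 0 ∧ f.natDegree = d := by
    obtain ⟨f, hf0, hf⟩ := exists_aeval_eq_zero hx
    exact ⟨_, f, hf0, hf, rfl⟩
  obtain ⟨f, hf0, hf, hd⟩ := Nat.find_spec hex
  have hdeg : f.natDegree ≠ 0 := by
    intro h0
    rw [Polynomial.eq_C_of_natDegree_eq_zero h0, Polynomial.aeval_C] at hf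
    apply hf0
    rw [Polynomial.eq_C_of_natDegree_eq_zero h0, Subtype.ext (a2 := (0 : Z)) hf, map_zero]
  have hchar : CharZero Z := ⟨fun a b hab => by
    have := congrArg (fun z : Z => ((z : O) : L)) hab
    simpa using this⟩
  have hder : Polynomial.derivative f ≠ 0 := fun h0 =>
    hdeg (Polynomial.derivative_eq_zero.1 h0)
  refine ⟨Polynomial.aeval x (Polynomial.derivative f), fun h0 => ?_, ?_⟩
  · have hlt := Polynomial.natDegree_derivative_lt hdeg
    rw [hd] at hlt
    exact Nat.find_min hex hlt ⟨_, hder, h0, rfl⟩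
  · have := DZ.map_aeval f x
    rw [hf, map_zero] at this
    exact this.symm

theorem Setting.exists_natCast_eq {k : Subfield L} (h : Setting O k ϖ p) :
    ∃ c : O, (p : O) = ⟨ϖ, h.mem⟩ * c := by
  obtain ⟨c, hc, hpc⟩ := h.p_mem
  exact ⟨⟨c, hc⟩, Subtype.ext (by simpa using hpc)⟩

/-- A separated module spanned by the image of a derivation is generated by the differentials of
the variable and of the uniformizer. -/
theorem Coordinates.exists_eq_smul_derivation {k : Subfield L} (C : Coordinates O k ϖ)
    (h : Setting O k ϖ p)
    (hN : ∀ y : N, (∀ n : ℕ, ∃ z : N, y = (⟨ϖ, h.mem⟩ : O) ^ n • z) → y = 0)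
    (D : Derivation ℤ O N) (hD : Submodule.span O (Set.range D) = ⊤) (y : N) :
    ∃ a b : O, y = a • D ⟨C.X, C.X_mem h⟩ + b • D ⟨ϖ, h.mem⟩ := by
  set X : O := ⟨C.X, C.X_mem h⟩ with hX
  set π : O := ⟨ϖ, h.mem⟩ with hπ
  obtain ⟨e, he⟩ := h.exists_natCast_eq
  -- The combinations of `D X` and `D π` modulo `π`. It contains every `D x`: expand `x` over `p`-th
  -- powers and use that `D (g ^ p)` is divisible by `p`, hence by `π`.
  let P : Submodule O N :=
    { carrier := {y | ∃ (a b : O) (z : N), y = a • D X + b • D π + π • z}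
      add_mem' := by
        rintro _ _ ⟨a, b, z, rfl⟩ ⟨a', b', z', rfl⟩
        exact ⟨a + a', b + b', z + z', by module⟩
      zero_mem' := ⟨0, 0, 0, by simp⟩
      smul_mem' := by
        rintro c _ ⟨a, b, z, rfl⟩
        exact ⟨c * a, c * b, c • z, by module⟩ }
  have hP : ∀ y : N, y ∈ P := by
    have hle : Submodule.span O (Set.range D) ≤ P := by
      rw [Submodule.span_le]
      rintro _ ⟨x, rfl⟩
      obtain ⟨g, y, hg, hy, hxg, -⟩ := C.exists_pow_expansion h 1 x.2
      have hx : x = ∑ j ∈ Finset.range (p ^ 1), (⟨g j, hg j⟩ : O) ^ p * X ^ j + π * ⟨y, hy⟩ := by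
        refine Subtype.ext ?_
        push_cast
        rw [hxg, pow_one]
      rw [hx, map_add, map_sum]
      refine P.add_mem (P.sum_mem fun j _ => ?_) ?_
      · rw [D.leibniz, D.leibniz_pow, D.leibniz_pow]
        refine ⟨(⟨g j, hg j⟩ : O) ^ p * (j : O) * X ^ (j - 1), 0,
          (X ^ j * e * (⟨g j, hg j⟩ : O) ^ (p - 1)) • D ⟨g j, hg j⟩, ?_⟩
        rw [← Nat.cast_smul_eq_nsmul O, ← Nat.cast_smul_eq_nsmul O, he]
        module
      · rw [D.leibniz]
        exact ⟨0, ⟨y, hy⟩, D ⟨y, hy⟩, by module⟩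
    intro y
    exact hle (hD ▸ Submodule.mem_top)
  choose a b z hz using hP
  -- The successive remainders. The coefficients converge in the complete ring `O`, and
  -- separatedness of `N`, which need not be complete, gives equality in the limit.
  let Y : ℕ → N := fun n => z^[n] y
  have hlim : ∀ f : N → O, ∃ F : O, ∀ n, ∃ r : O,
      F = ∑ i ∈ Finset.range n, π ^ i * f (Y i) + π ^ n * r := by
    intro f
    obtain ⟨F, hF, hFn⟩ := h.complete
      (fun n => ((∑ i ∈ Finset.range n, π ^ i * f (Y i) : O) : L)) (fun n => Subtype.property _)
      (fun n => by
        rw [Finset.sum_range_succ]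
        push_cast
        rw [add_sub_cancel_left]
        exact ⟨_, (f (Y n)).2, rfl⟩)
    refine ⟨⟨F, hF⟩, fun n => ?_⟩
    obtain ⟨r, hr, hFr⟩ := hFn n
    refine ⟨⟨r, hr⟩, Subtype.ext ?_⟩
    push_cast at hFr ⊢
    rw [← hFr]
    ring
  obtain ⟨F, hF⟩ := hlim a
  obtain ⟨G, hG⟩ := hlim b
  have hpart : ∀ n, y = (∑ i ∈ Finset.range n, π ^ i * a (Y i)) • D X +
      (∑ i ∈ Finset.range n, π ^ i * b (Y i)) • D π + π ^ n • Y n := by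
    intro n
    induction n with
    | zero => simp [Y]
    | succ n ih =>
      have hYn : Y n = a (Y n) • D X + b (Y n) • D π + π • Y (n + 1) := by
        simp only [Y, Function.iterate_succ_apply']
        exact hz _
      conv_lhs => rw [ih, hYn]
      rw [Finset.sum_range_succ, Finset.sum_range_succ]
      module
  refine ⟨F, G, ?_⟩
  rw [← sub_eq_zero]
  refine hN _ fun n => ?_
  obtain ⟨r, hr⟩ := hF n
  obtain ⟨r', hr'⟩ := hG n
  refine ⟨Y n - r • D X - r' • D π, ?_⟩
  rw [hr, hr']
  conv_lhs => rw [hpart n]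
  module

end Derivations

/-! ### The continuous differentials are one-dimensional -/

section Differentials

variable {L : Type u} [Field L] {O : ValuationSubring L} {ϖ : L} {p : ℕ} (K : Subfield L)

theorem Setting.mem_maximalIdeal {k : Subfield L} (h : Setting O k ϖ p) :
    (⟨ϖ, h.mem⟩ : O) ∈ IsLocalRing.maximalIdeal O := by
  rw [ValuationSubring.valuation_lt_one_iff]
  exact h.valuation_lt_one

/-- The quotient is itself separated, since the submodule divided out lies in every `𝔪 ^ n M`. -/
theorem Setting.sep_eq_zero {k : Subfield L} (h : Setting O k ϖ p) {M : Type*} [AddCommGroup M]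
    [Module O M] (y : Sep O M) (hy : ∀ n : ℕ, ∃ z : Sep O M, y = (⟨ϖ, h.mem⟩ : O) ^ n • z) :
    y = 0 := by
  obtain ⟨x, rfl⟩ := Submodule.Quotient.mk_surjective _ y
  rw [Submodule.Quotient.mk_eq_zero, Submodule.mem_iInf]
  intro n
  obtain ⟨z, hz⟩ := hy n
  obtain ⟨w, rfl⟩ := Submodule.Quotient.mk_surjective _ z
  rw [← Submodule.Quotient.mk_smul, Submodule.Quotient.eq, Submodule.mem_iInf] at hz
  have h1 := Submodule.smul_mem_smul (Ideal.pow_mem_pow h.mem_maximalIdeal n)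
    (Submodule.mem_top (R := O) (x := w))
  have := add_mem (hz n) h1
  rwa [sub_add_cancel] at this

variable (O) in
/-- The universal derivation into the separated module of differentials. -/
noncomputable def sepDerivation : Derivation ℤ O (Sep O (Ω[O⁄baseRing O K])) :=
  Derivation.mk' ((Submodule.mkQ _).toAddMonoidHom.comp
    (KaehlerDifferential.D (baseRing O K) O).toLinearMap.toAddMonoidHom).toIntLinearMap
    fun x y => by
      change Submodule.Quotient.mk (KaehlerDifferential.D (baseRing O K) O (x * y)) = _
      rw [Derivation.leibniz]
      rfl

theorem dCts_eq (x : O) : dCts O K x = (1 : L) ⊗ₜ[O] sepDerivation O K x := rfl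

theorem span_range_sepDerivation : Submodule.span O (Set.range (sepDerivation O K)) = ⊤ := by
  have h1 := KaehlerDifferential.span_range_derivation (baseRing O K) O
  have h2 : Set.range (sepDerivation O K) =
      (Submodule.mkQ (⨅ n : ℕ, (IsLocalRing.maximalIdeal O ^ n • ⊤ :
        Submodule O (Ω[O⁄baseRing O K])))) ''
        Set.range (KaehlerDifferential.D (baseRing O K) O) := by
    rw [← Set.range_comp]
    rfl
  rw [h2, Submodule.span_image, h1, Submodule.map_top, Submodule.range_mkQ]

/-- The uniformizer is a constant, so its differential is torsion and dies over `L`; of the two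
generators only `dX` is left. -/
theorem Coordinates.exists_eq_smul_dCts (C : Coordinates O (constantField O) ϖ)
    (h : Setting O (constantField O) ϖ p) (ω : ContDifferentials O K) :
    ∃ f : L, ω = f • dCts O K ⟨C.X, C.X_mem h⟩ := by
  obtain ⟨c, hc0, hc⟩ := h.exists_smul_derivation_eq_zero h.sep_eq_zero (sepDerivation O K)
    (x := ⟨ϖ, h.mem⟩) h.mem_k
  induction ω using TensorProduct.induction_on with
  | zero => exact ⟨0, by simp⟩
  | add a b ha hb =>
    obtain ⟨f, rfl⟩ := ha
    obtain ⟨g, rfl⟩ := hb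
    exact ⟨f + g, (add_smul _ _ _).symm⟩
  | tmul l y =>
    obtain ⟨a, b, rfl⟩ := C.exists_eq_smul_derivation h h.sep_eq_zero (sepDerivation O K)
      (span_range_sepDerivation K) y
    refine ⟨l * a, ?_⟩
    have hzero : ∀ m : L, m ⊗ₜ[O] sepDerivation O K ⟨ϖ, h.mem⟩ = 0 := by
      intro m
      have hcL : (c : L) ≠ 0 := fun h0 => hc0 (Subtype.ext h0)
      have hm : m = c • (m / c) := by
        rw [Algebra.smul_def]
        exact (mul_div_cancel₀ _ hcL).symm
      rw [hm, TensorProduct.smul_tmul, hc, TensorProduct.tmul_zero]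
    rw [TensorProduct.tmul_add, TensorProduct.tmul_smul _ l, TensorProduct.tmul_smul _ l, hzero,
      smul_zero, add_zero, dCts_eq, TensorProduct.smul_tmul', TensorProduct.smul_tmul',
      Algebra.smul_def, smul_eq_mul, mul_one, mul_comm]
    rfl

/-- The linear map on the continuous differentials given by the derivative of series. -/
theorem Coordinates.exists_evaluation (C : Coordinates O (constantField O) ϖ)
    (h : Setting O (constantField O) ϖ p) (hK : IsLocalField K) :
    ∃ ev : ContDifferentials O K →ₗ[L] L, ∀ x : O, ev (dCts O K x) = C.derivative x := by
  let δ : Derivation (baseRing O K) O O := Derivation.mk'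
    { toFun := fun x => ⟨C.derivative x, C.derivative_mem h x.2⟩
      map_add' := fun x y => Subtype.ext (C.derivative_add x y)
      map_smul' := fun z x => by
        refine Subtype.ext ?_
        change C.derivative ((z : O) * x) = (z : O) * C.derivative x
        rw [C.derivative_mul h, C.derivative_const (c := ((z : O) : L))
          (h.le_constantField hK (x := ((z : O) : L)) z.2 z.1.2), zero_mul,
          add_zero] }
    fun x y => by
      refine Subtype.ext ?_
      change C.derivative (x * y) = x * C.derivative y + y * C.derivative x
      rw [C.derivative_mul h, mul_comm (y : L)]
  -- The map factors through the separated quotient because its target `O` is Hausdorff.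
  let e : Sep O (Ω[O⁄baseRing O K]) →ₗ[O] O := Submodule.liftQ _ δ.liftKaehlerDifferential (by
    intro y hy
    rw [LinearMap.mem_ker]
    have hmem : ∀ n : ℕ, δ.liftKaehlerDifferential y ∈ IsLocalRing.maximalIdeal O ^ n := by
      intro n
      have h1 := Submodule.mem_map_of_mem (f := δ.liftKaehlerDifferential)
        ((Submodule.mem_iInf _).1 hy n)
      rw [Submodule.map_smul''] at h1
      have h2 := Submodule.smul_mono le_rfl le_top h1
      rwa [smul_eq_mul, Ideal.mul_top] at h2
    have := h.complete_dvr.complete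
    exact IsHausdorff.haus this.toIsHausdorff _ fun n => by
      rw [SModEq.zero, smul_eq_mul, Ideal.mul_top]
      exact hmem n)
  refine ⟨LinearMap.liftBaseChange L ((Algebra.linearMap O L).comp e), fun x => ?_⟩
  rw [dCts_eq, LinearMap.liftBaseChange_tmul, one_smul]
  change ((δ.liftKaehlerDifferential (KaehlerDifferential.D (baseRing O K) O x) : O) : L) = _
  rw [Derivation.liftKaehlerDifferential_comp_D]
  rfl

end Differentials

end TwoDimLocal

/-! ### The residue map -/

theorem mainTheorem7 {L : Type*} [Field L] (O : ValuationSubring L)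
    (hL : TwoDimLocal.IsMixedTwoDimLocalField O) (hstd : TwoDimLocal.IsStandard O)
    (K : Subfield L) (hK : TwoDimLocal.IsLocalField K) :
    ∃ res : TwoDimLocal.ContDifferentials O K →ₗ[TwoDimLocal.constantField O]
        TwoDimLocal.constantField O,
      ∀ φ : TwoDimLocal.DoubleCurly
          (TwoDimLocal.integersOf O (TwoDimLocal.constantField O)) ≃+* L,
        (∀ c : TwoDimLocal.constantField O,
          φ (TwoDimLocal.DoubleCurly.monomial _ 0 c) = (c : L)) →
        ∃ t : O, TwoDimLocal.IsFirstLocalParameter O t ∧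
          φ (TwoDimLocal.DoubleCurly.monomial _ 1 1) = (t : L) ∧
          (∀ ω : TwoDimLocal.ContDifferentials O K, ∃! f : L, ω = f • TwoDimLocal.dCts O K t) ∧
          ∀ f : L, res (f • TwoDimLocal.dCts O K t) = -(φ.symm f).coeff (-1) := by
  obtain ⟨ϖ, p, h⟩ := hL.exists_setting hstd
  obtain ⟨A, hA⟩ := hL.residue
  -- One fixed isomorphism defines the residue; if there is none, the condition is vacuous and the
  -- zero map serves.
  by_cases hex : ∃ φ : TwoDimLocal.DoubleCurly
      (TwoDimLocal.integersOf O (TwoDimLocal.constantField O)) ≃+* L,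
      ∀ c : TwoDimLocal.constantField O, φ (TwoDimLocal.DoubleCurly.monomial _ 0 c) = (c : L)
  · obtain ⟨φ₀, hφ₀⟩ := hex
    let C := h.coordinates φ₀ hφ₀
    obtain ⟨ev, hev⟩ := C.exists_evaluation K h hK
    let res : TwoDimLocal.ContDifferentials O K →ₗ[TwoDimLocal.constantField O]
        TwoDimLocal.constantField O :=
      { toFun := fun ω => -(φ₀.symm (ev ω)).coeff (-1)
        map_add' := fun ω η => by
          refine Subtype.ext ?_
          change -C.coeff (-1) (ev (ω + η)) = -C.coeff (-1) (ev ω) + -C.coeff (-1) (ev η)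
          rw [map_add, map_add, neg_add]
        map_smul' := fun c ω => by
          refine Subtype.ext ?_
          change -C.coeff (-1) (ev (c • ω)) = (c : L) * -C.coeff (-1) (ev ω)
          have hc : c • ω = (c : L) • ω := (algebraMap_smul L c ω).symm
          rw [hc, map_smul, smul_eq_mul, C.coeff_const_mul h.toIsUniformizer c.2, mul_neg] }
    refine ⟨res, fun φ hφ => ?_⟩
    let C' := h.coordinates φ hφ
    obtain ⟨ev', hev'⟩ := C'.exists_evaluation K h hK
    refine ⟨⟨C'.X, C'.X_mem h⟩, C'.isFirstLocalParameter_X h hA, rfl, fun ω => ?_, fun f => ?_⟩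
    · obtain ⟨f, hf⟩ := C'.exists_eq_smul_dCts K h ω
      refine ⟨f, hf, fun g hg => ?_⟩
      -- The functional recovers `f` from `f dX'`, which gives uniqueness of the coefficient.
      have hev1 : ∀ f : L, ev' (f • TwoDimLocal.dCts O K ⟨C'.X, C'.X_mem h⟩) = f := fun f => by
        rw [map_smul, hev', smul_eq_mul, C'.derivative_X, mul_one]
      rw [← hev1 g, ← hg, hf, hev1]
    · refine Subtype.ext ?_
      change -C.coeff (-1) (ev (f • TwoDimLocal.dCts O K ⟨C'.X, C'.X_mem h⟩)) =
        -C'.coeff (-1) f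
      rw [map_smul, hev, smul_eq_mul,
        C.coeff_neg_one_mul_derivative h hA.toIsCompleteDVR C']
  · exact ⟨0, fun φ hφ => absurd ⟨φ, hφ⟩ hex⟩
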